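/- Conventions. All algebras are associative unital algebras over $\mathbb C$, ideals are two-sided, and Sweedler notation is used. A finite family of ideals $(J_i)_{i\in I}$ of an algebra $A$ is a complete covering if $\bigcap_i J_i=0$ and every family $(b_i)\in\prod_i A/J_i$ whose members $b_i,b_j$ agree in $A/(J_i+J_j)$ for all $i,j$ comes from an element of $A$. A differential calculus over $A$ is an $\mathbb N$-graded algebra $\Gamma(A)$ with $\Gamma^0(A)=A$ and a graded derivation $d$ of degree $1$ with $d^2=0$, generated by $A$ and $dA$. The skew tensor product $\Gamma(A)\hat\otimes\Gamma(C)$ has product $(\gamma\hat\otimes\rho)(\omega\hat\otimes\tau)=(-1)^{mn}\gamma\omega\hat\otimes\rho\tau$ for $\omega$ of degree $n$ and $\rho$ of degree $m$, and $d(\gamma\hat\otimes\rho)=d\gamma\hat\otimes\rho+(-1)^n\gamma\hat\otimes d\rho$ for $\gamma$ of degree $n$. Bundle. Let $H$ be a Hopf algebra with bijective antipode $S$. Let $\mathcal P$ be a locally trivial quantum principal fibre bundle over $B$ with structure group $H$: $\mathcal P$ is a right $H$-comodule algebra with coaction $\Delta_{\mathcal P}$, $(J_i)_{i\in I}$ is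 a complete covering of $B$, $B_i=B/J_i$ with quotient maps $\pi_i$, and there are a surjective homomorphism $\chi_i:\mathcal P\to B_i\otimes H$ for each $i$ and an injective homomorphism $\iota:B\to\mathcal P$ such that $(\mathrm{id}\otimes\Delta)\chi_i=(\chi_i\otimes\mathrm{id})\Delta_{\mathcal P}$, $\chi_i(\iota(b))=\pi_i(b)\otimes 1$, $(\ker\chi_i)_{i}$ is a complete covering of $\mathcal P$, and $\iota(B)=\{f:\Delta_{\mathcal P}(f)=f\otimes1\}$. Differential structure. Let $\Gamma(B_i)$ be differential calculi over $B_i$ and $\Gamma(H)$ a right covariant differential calculus over $H$ with coaction $\Delta^\Gamma$. Let $\Gamma(\mathcal P)=\Omega(\mathcal P)/\bigcap_i\ker(\Omega(\mathcal P)\to\Gamma(B_i)\hat\otimes\Gamma(H))$ and $\Gamma(B)=\Omega(B)/\bigcap_i\ker(\Omega(B)\to\Gamma(B_i))$, where $\Omega$ denotes the universal calculus and the maps extend $\chi_i$ and $\pi_i$. Let $\Gamma_c(\mathcal P)\subset\bigoplus_i\Gamma(B_i)\hat\otimes\Gamma(H)$ and $\Gamma_c(B)\subset\bigoplus_i\Gamma(B_i)$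 be their covering completions with respect to the kernels of the induced maps to the summands (families of elements that agree in the quotients by the sums of two of these kernels). Write $\chi_i$ also for the $i$-th projection of $\Gamma_c(\mathcal P)$; $\Gamma_c(\mathcal P)$ and the direct sum carry the componentwise differential and the coaction $\Delta^{\Gamma}_{\mathcal P}$ given componentwise by $\mathrm{id}\otimes\Delta^\Gamma$, written $\gamma\mapsto\sum\gamma_0\otimes\gamma_1$. Regard $\Gamma_c(B)$ as a subalgebra of $\Gamma_c(\mathcal P)$ by $(\gamma_i)_i\mapsto(\gamma_i\hat\otimes1)_i$. Let $\mathrm{hor}\,\Gamma_c(\mathcal P)=\{\gamma\in\Gamma_c(\mathcal P):\chi_i(\gamma)\in\Gamma(B_i)\hat\otimes H\ \forall i\}$. Covariant derivatives. A left (right) covariant derivative is a linear map $D$ ($=D_l$ or $D_r$) of $\mathrm{hor}\,\Gamma_c(\mathcal P)$ into itself that raises the degree by $1$, satisfies $D(1)=0$, commutes with the coaction, maps $\ker\chi_i\cap\mathrm{hor}\,\Gamma_c(\mathcal P)$ into itself for every $i$, and satisfies, in the left case, $D_l(\gamma\alpha)=(d\gamma)\alpha+(-1)^n\gamma D_l(\alpha)$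 for $\gamma\in\Gamma_c^n(B)$, $\alpha\in\mathrm{hor}\,\Gamma_c(\mathcal P)$, and in the right case $D_r(\alpha\gamma)=D_r(\alpha)\gamma+(-1)^n\alpha\,d\gamma$ for $\alpha\in\mathrm{hor}\,\Gamma_c^n(\mathcal P)$, $\gamma\in\Gamma_c(B)$. Since $D$ preserves these kernels, it induces maps $D_i$ of $\Gamma(B_i)\hat\otimes H$ with $D_i\chi_i=\chi_iD$; put $A_i(h)=-(\mathrm{id}\otimes\varepsilon)D_i(1\otimes h)$. Pre-connection forms. Let $\mathrm{hor}_c$ be the projection of $\Gamma(B_i)\hat\otimes\Gamma(H)$ onto $\Gamma(B_i)\hat\otimes H$ that annihilates $\gamma\hat\otimes\theta$ for $\theta$ of positive degree. A left (right) pre-connection form is a linear map $\omega=\omega_l$ ($\omega_r$) $:H\to\Gamma^1_c(\mathcal P)$ with $\omega(1)=0$, with $\Delta^\Gamma_{\mathcal P}(\omega_l(h))=\sum\omega_l(h_2)\otimes S(h_1)h_3$ (respectively $\Delta^\Gamma_{\mathcal P}(\omega_r(h))=\sum\omega_r(h_2)\otimes h_3S^{-1}(h_1)$), and with $(1-\mathrm{hor}_c)\chi_i(\omega_l(h))=-\sum1\hat\otimes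 S(h_1)dh_2$ (respectively $(1-\mathrm{hor}_c)\chi_i(\omega_r(h))=-\sum1\hat\otimes(dh_2)S^{-1}(h_1)$) for all $i$. It is the pre-connection form of $D$ if $A_i(h)=-(\mathrm{id}\otimes\varepsilon)\,\mathrm{hor}_c\,\chi_i(\omega(h))$ for all $i$ and $h$. The curvature form of $D$ is defined by the structure equation $$\Omega_l(h)=d\omega_l(h)-\sum\omega_l(h_1)\omega_l(h_2),\qquad \Omega_r(h)=d\omega_r(h)+\sum\omega_r(h_2)\omega_r(h_1).$$ Proposition 16. Let $D_l$ (respectively $D_r$) be a left (right) covariant derivative with left (right) pre-connection form $\omega_l$ ($\omega_r$) and curvature form $\Omega_l$ ($\Omega_r$). Then for all $\gamma\in\mathrm{hor}\,\Gamma_c(\mathcal P)$ $$D_l^2(\gamma)=\sum\gamma_0\,\Omega_l(\gamma_1),\qquad D_r^2(\gamma)=\sum\Omega_r(\gamma_1)\,\gamma_0 .$$ -/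

import Mathlib

open scoped TensorProduct

noncomputable section

namespace QPFB

universe u v w x

/-! ### Differential calculi -/

/-- A differential calculus `Γ(A)` over a complex algebra `A`: an `ℕ`-graded algebra with
`Γ⁰(A) = A`, a graded derivation `d` of degree one with `d² = 0`, generated by `A` and `dA`. -/
structure DifferentialCalculus (A : Type u) [Ring A] [Algebra ℂ A] where
  carrier : Type v
  [ring : Ring carrier]
  [algebra : Algebra ℂ carrier]
  /-- the component `Γⁿ(A)` -/
  grading : ℕ → Submodule ℂ carrier
  [graded : GradedAlgebra grading]
  /-- the identification of `A` with `Γ⁰(A)` -/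
  incl : A →ₐ[ℂ] carrier
  incl_injective : Function.Injective incl
  range_incl : LinearMap.range incl.toLinearMap = grading 0
  /-- the differential -/
  d : carrier →ₗ[ℂ] carrier
  d_mem : ∀ (n : ℕ) (a : carrier), a ∈ grading n → d a ∈ grading (n + 1)
  leibniz : ∀ (n : ℕ) (a b : carrier), a ∈ grading n →
    d (a * b) = d a * b + (-1 : ℂ) ^ n • (a * d b)
  d_d : ∀ a : carrier, d (d a) = 0
  generated : Algebra.adjoin ℂ (Set.range incl ∪ Set.range fun a : A => d (incl a)) = ⊤

attribute [instance] DifferentialCalculus.ring DifferentialCalculus.algebra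
  DifferentialCalculus.graded

namespace DifferentialCalculus

variable {A : Type u} [Ring A] [Algebra ℂ A] (Γ : DifferentialCalculus.{u, v} A)

/-- The grading involution, `γ ↦ (-1)ⁿ γ` on `Γⁿ(A)`. -/
def parity : Γ.carrier →ₗ[ℂ] Γ.carrier :=
  DirectSum.toModule ℂ ℕ Γ.carrier (fun n => (-1 : ℂ) ^ n • (Γ.grading n).subtype) ∘ₗ
    (DirectSum.decomposeLinearEquiv Γ.grading).toLinearMap

/-- The projection of `Γ(A)` onto `Γ⁰(A)` along the components of positive degree. -/
def projZero : Γ.carrier →ₗ[ℂ] Γ.carrier := GradedAlgebra.proj Γ.grading 0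

theorem projZero_mem_range (a : Γ.carrier) :
    Γ.projZero a ∈ LinearMap.range Γ.incl.toLinearMap := by
  rw [Γ.range_incl]
  exact SetLike.coe_mem _

/-- The projection of `Γ(A)` onto the degree zero component, as a map to `A`. -/
def degreeZero : Γ.carrier →ₗ[ℂ] A :=
  (LinearEquiv.ofInjective Γ.incl.toLinearMap Γ.incl_injective).symm.toLinearMap ∘ₗ
    LinearMap.codRestrict _ Γ.projZero Γ.projZero_mem_range

theorem parity_of_mem {n : ℕ} {a : Γ.carrier} (ha : a ∈ Γ.grading n) :
    Γ.parity a = (-1 : ℂ) ^ n • a := by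
  have h : DirectSum.decomposeLinearEquiv Γ.grading a =
      DirectSum.lof ℂ ℕ (fun n => Γ.grading n) n ⟨a, ha⟩ := DirectSum.decompose_of_mem _ ha
  rw [parity, LinearMap.comp_apply, LinearEquiv.coe_coe, h, DirectSum.toModule_lof]
  rfl

theorem incl_mem (a : A) : Γ.incl a ∈ Γ.grading 0 := by
  rw [← Γ.range_incl]
  exact ⟨a, rfl⟩

theorem parity_incl (a : A) : Γ.parity (Γ.incl a) = Γ.incl a := by
  simp [Γ.parity_of_mem (Γ.incl_mem a)]

theorem d_one : Γ.d 1 = 0 := by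
  have h := Γ.leibniz 0 1 1 (by simpa using Γ.incl_mem 1)
  simpa using h

theorem induction_homogeneous {p : Γ.carrier → Prop} (a : Γ.carrier)
    (hom : ∀ (n : ℕ) (a : Γ.carrier), a ∈ Γ.grading n → p a)
    (add : ∀ a b, p a → p b → p (a + b)) : p a :=
  DirectSum.Decomposition.inductionOn Γ.grading (hom 0 0 (Submodule.zero_mem _))
    (fun {i} m => hom i m m.2) add a

theorem parity_mul (a b : Γ.carrier) : Γ.parity (a * b) = Γ.parity a * Γ.parity b := by
  induction a using Γ.induction_homogeneous with
  | add a a' h h' => simp [add_mul, h, h']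
  | hom n a ha =>
    induction b using Γ.induction_homogeneous with
    | add b b' h h' => simp [mul_add, h, h']
    | hom m b hb =>
      rw [Γ.parity_of_mem ha, Γ.parity_of_mem hb, Γ.parity_of_mem (SetLike.mul_mem_graded ha hb)]
      simp [pow_add, smul_smul, mul_comm]

/-- The grading involution as a homomorphism of algebras. -/
def parityHom : Γ.carrier →ₐ[ℂ] Γ.carrier :=
  AlgHom.ofLinearMap Γ.parity (by simpa using Γ.parity_incl 1) Γ.parity_mul

end DifferentialCalculus

/-! ### Hopf algebras, coactions and covariant calculi -/

section Hopf

variable (H : Type w) [Ring H] [HopfAlgebra ℂ H]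

/-- A right coaction of `H` making the algebra `A` into a right `H`-comodule algebra. -/
structure RightCoaction (A : Type u) [Ring A] [Algebra ℂ A] where
  coact : A →ₐ[ℂ] A ⊗[ℂ] H
  coassoc : ∀ a : A, TensorProduct.assoc ℂ A H H (coact.toLinearMap.rTensor H (coact a)) =
    (Coalgebra.comul (R := ℂ) (A := H)).lTensor A (coact a)
  counit : ∀ a : A, TensorProduct.rid ℂ A
    ((Coalgebra.counit (R := ℂ) (A := H)).lTensor A (coact a)) = a

variable {H}

/-- Right covariance of a calculus `Γ(H)`: a right coaction `Δ^Γ` making `Γ(H)` into a right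
`H`-comodule algebra, with
`Δ^Γ(h₀ dh₁ ⋯ dhₙ) = Δ(h₀) (d ⊗ id)Δ(h₁) ⋯ (d ⊗ id)Δ(hₙ)`. Because `Δ^Γ` is multiplicative, this
formula is expressed by its values on `h` and on `dh`. -/
structure RightCovariant (Γ : DifferentialCalculus.{w, v} H)
    extends RightCoaction H Γ.carrier where
  coact_incl : ∀ h : H, coact (Γ.incl h) =
    Γ.incl.toLinearMap.rTensor H (Coalgebra.comul (R := ℂ) h)
  coact_d : ∀ h : H, coact (Γ.d (Γ.incl h)) =
    (Γ.d ∘ₗ Γ.incl.toLinearMap).rTensor H (Coalgebra.comul (R := ℂ) h)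

/-- The inverse of a bijective antipode. -/
def antipodeInv (hS : Function.Bijective (HopfAlgebra.antipode ℂ (A := H))) : H →ₗ[ℂ] H :=
  (LinearEquiv.ofBijective (HopfAlgebra.antipode ℂ (A := H)) hS).symm.toLinearMap

/-- `h ↦ ∑ h₁ ⊗ (h₂ ⊗ h₃)`. -/
def comul₃ : H →ₗ[ℂ] H ⊗[ℂ] (H ⊗[ℂ] H) :=
  (Coalgebra.comul (R := ℂ) (A := H)).lTensor H ∘ₗ Coalgebra.comul (R := ℂ)

/-- `h ↦ ∑ h₂ ⊗ S(h₁) h₃`. -/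
def adLeft : H →ₗ[ℂ] H ⊗[ℂ] H :=
  (LinearMap.mul' ℂ H).lTensor H ∘ₗ (TensorProduct.leftComm ℂ H H H).toLinearMap ∘ₗ
    (HopfAlgebra.antipode ℂ (A := H)).rTensor (H ⊗[ℂ] H) ∘ₗ comul₃

/-- `h ↦ ∑ h₂ ⊗ h₃ S⁻¹(h₁)`. -/
def adRight (hS : Function.Bijective (HopfAlgebra.antipode ℂ (A := H))) : H →ₗ[ℂ] H ⊗[ℂ] H :=
  (LinearMap.mul' ℂ H ∘ₗ (TensorProduct.comm ℂ H H).toLinearMap).lTensor H ∘ₗ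
    (TensorProduct.leftComm ℂ H H H).toLinearMap ∘ₗ
    (antipodeInv hS).rTensor (H ⊗[ℂ] H) ∘ₗ comul₃

variable (Γ : DifferentialCalculus.{w, v} H)

/-- `h ↦ ∑ S(h₁) dh₂`. -/
def maurerCartanLeft : H →ₗ[ℂ] Γ.carrier :=
  LinearMap.mul' ℂ Γ.carrier ∘ₗ
    TensorProduct.map (Γ.incl.toLinearMap ∘ₗ HopfAlgebra.antipode ℂ (A := H))
      (Γ.d ∘ₗ Γ.incl.toLinearMap) ∘ₗ Coalgebra.comul (R := ℂ)

/-- `h ↦ ∑ (dh₂) S⁻¹(h₁)`. -/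
def maurerCartanRight (hS : Function.Bijective (HopfAlgebra.antipode ℂ (A := H))) :
    H →ₗ[ℂ] Γ.carrier :=
  LinearMap.mul' ℂ Γ.carrier ∘ₗ (TensorProduct.comm ℂ Γ.carrier Γ.carrier).toLinearMap ∘ₗ
    TensorProduct.map (Γ.incl.toLinearMap ∘ₗ antipodeInv hS)
      (Γ.d ∘ₗ Γ.incl.toLinearMap) ∘ₗ Coalgebra.comul (R := ℂ)

theorem coact_parity {Γ : DifferentialCalculus.{w, v} H} (c : RightCovariant Γ)
    (a : Γ.carrier) : c.coact (Γ.parity a) = Γ.parity.rTensor H (c.coact a) := by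
  have key : c.coact.comp Γ.parityHom =
      (Algebra.TensorProduct.map Γ.parityHom (AlgHom.id ℂ H)).comp c.coact := by
    refine AlgHom.ext_of_adjoin_eq_top Γ.generated ?_
    rintro _ (⟨h, rfl⟩ | ⟨h, rfl⟩)
    · change c.coact (Γ.parity (Γ.incl h)) = Γ.parity.rTensor H (c.coact (Γ.incl h))
      rw [Γ.parity_incl, c.coact_incl, ← LinearMap.comp_apply (Γ.parity.rTensor H),
        ← LinearMap.rTensor_comp]
      congr 2
      ext a
      simp [Γ.parity_incl]
    · have hp (a : H) : Γ.parity (Γ.d (Γ.incl a)) = - Γ.d (Γ.incl a) := by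
        simp [Γ.parity_of_mem (Γ.d_mem _ _ (Γ.incl_mem a))]
      change c.coact (Γ.parity (Γ.d (Γ.incl h))) = Γ.parity.rTensor H (c.coact (Γ.d (Γ.incl h)))
      rw [hp, map_neg, c.coact_d, ← LinearMap.comp_apply (Γ.parity.rTensor H),
        ← LinearMap.rTensor_comp, ← LinearMap.neg_apply, ← LinearMap.rTensor_neg]
      congr 2
      ext a
      simp [hp]
  exact DFunLike.congr_fun key a

end Hopf

/-! ### The skew tensor product of two calculi -/

section Skew

variable {A : Type u} [Ring A] [Algebra ℂ A] {H : Type w} [Ring H] [HopfAlgebra ℂ H]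
  (Γ : DifferentialCalculus.{u, v} A) (Θ : DifferentialCalculus.{w, x} H)

/-- The skew tensor product `Γ(A) ⊗̂ Γ(H)`, with
`(γ ⊗̂ ρ)(ω ⊗̂ τ) = (-1)^{mn} γω ⊗̂ ρτ` for `ω` of degree `n` and `ρ` of degree `m`. -/
abbrev Skew : Type _ := Γ.grading ᵍ⊗[ℂ] Θ.grading

/-- The identity map from the tensor product of vector spaces to the skew tensor product. -/
abbrev toSkew : Γ.carrier ⊗[ℂ] Θ.carrier ≃ₗ[ℂ] Skew Γ Θ :=
  GradedTensorProduct.of ℂ Γ.grading Θ.grading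

/-- The differential `d(γ ⊗̂ ρ) = dγ ⊗̂ ρ + (-1)ⁿ γ ⊗̂ dρ`, for `γ` of degree `n`. -/
def skewD : Skew Γ Θ →ₗ[ℂ] Skew Γ Θ :=
  (toSkew Γ Θ).toLinearMap ∘ₗ
    (TensorProduct.map Γ.d LinearMap.id + TensorProduct.map Γ.parity Θ.d) ∘ₗ
      (toSkew Γ Θ).symm.toLinearMap

/-- The elements of total degree `n` of the skew tensor product. -/
def skewDegree (n : ℕ) : Submodule ℂ (Skew Γ Θ) :=
  ⨆ p : {p : ℕ × ℕ // p.1 + p.2 = n},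
    (LinearMap.range (TensorProduct.map (Γ.grading p.1.1).subtype
      (Θ.grading p.1.2).subtype)).map (toSkew Γ Θ).toLinearMap

/-- The embedding of `A ⊗ H` into `Γ(A) ⊗̂ Γ(H)` as the component of degree zero. -/
def skewIncl : A ⊗[ℂ] H →ₗ[ℂ] Skew Γ Θ :=
  (toSkew Γ Θ).toLinearMap ∘ₗ TensorProduct.map Γ.incl.toLinearMap Θ.incl.toLinearMap

/-- The horizontal forms `Γ(A) ⊗̂ H` of `Γ(A) ⊗̂ Γ(H)`. -/
def skewHor : Submodule ℂ (Skew Γ Θ) :=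
  (LinearMap.range (Θ.incl.toLinearMap.lTensor Γ.carrier)).map (toSkew Γ Θ).toLinearMap

/-- The canonical connection of the trivial bundle: the projection `hor_c` onto `Γ(A) ⊗̂ H` which
annihilates `γ ⊗̂ θ` for `θ` of positive degree. -/
def horCanonical : Skew Γ Θ →ₗ[ℂ] Skew Γ Θ :=
  (toSkew Γ Θ).toLinearMap ∘ₗ Θ.projZero.lTensor Γ.carrier ∘ₗ (toSkew Γ Θ).symm.toLinearMap

/-- The map `id ⊗ ε : Γ(A) ⊗̂ H → Γ(A)` on horizontal forms, extended by zero to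
`γ ⊗̂ θ` for `θ` of positive degree. -/
def idCounit : Skew Γ Θ →ₗ[ℂ] Γ.carrier :=
  (TensorProduct.rid ℂ Γ.carrier).toLinearMap ∘ₗ
    (Coalgebra.counit (R := ℂ) (A := H) ∘ₗ Θ.degreeZero).lTensor Γ.carrier ∘ₗ
      (toSkew Γ Θ).symm.toLinearMap

variable {Θ} in
/-- The coaction `id ⊗ Δ^Γ` on `Γ(A) ⊗̂ Γ(H)`. -/
def skewCoact (c : RightCovariant Θ) : Skew Γ Θ →ₗ[ℂ] Skew Γ Θ ⊗[ℂ] H :=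
  (toSkew Γ Θ).toLinearMap.rTensor H ∘ₗ
    (TensorProduct.assoc ℂ Γ.carrier Θ.carrier H).symm.toLinearMap ∘ₗ
      c.coact.toLinearMap.lTensor Γ.carrier ∘ₗ (toSkew Γ Θ).symm.toLinearMap

theorem skew_induction {p : Skew Γ Θ → Prop} (x : Skew Γ Θ)
    (tmul : ∀ (a : Γ.carrier) (b : Θ.carrier), p (toSkew Γ Θ (a ⊗ₜ b)))
    (add : ∀ x y, p x → p y → p (x + y)) : p x := by
  obtain ⟨t, rfl⟩ := (toSkew Γ Θ).surjective x
  induction t with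
  | zero => simpa using tmul 0 0
  | tmul a b => exact tmul a b
  | add s t hs ht => rw [map_add]; exact add _ _ hs ht

/-- The product of the skew tensor product in terms of the grading involution. -/
theorem skew_mul {n : ℕ} (a : Γ.carrier) (b : Θ.carrier) {a' : Γ.carrier}
    (ha' : a' ∈ Γ.grading n) (b' : Θ.carrier) :
    toSkew Γ Θ (a ⊗ₜ b) * toSkew Γ Θ (a' ⊗ₜ b') =
      toSkew Γ Θ ((a * a') ⊗ₜ ((Θ.parity ^ n) b * b')) := by
  induction b using Θ.induction_homogeneous with
  | add b c hb hc =>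
    simp only [TensorProduct.tmul_add, map_add, add_mul, hb, hc]
  | hom m b hb =>
    have h := GradedTensorProduct.tmul_coe_mul_coe_tmul (R := ℂ) (𝒜 := Γ.grading)
      (ℬ := Θ.grading) a ⟨b, hb⟩ ⟨a', ha'⟩ b'
    have hp : (Θ.parity ^ n) b = ((-1 : ℂ) ^ (m * n)) • b := by
      rw [pow_mul]
      clear h ha'
      induction n with
      | zero => simp
      | succ n ih =>
        rw [pow_succ', Module.End.mul_apply, ih, map_smul, Θ.parity_of_mem hb, smul_smul,
          pow_succ]
    refine h.trans ?_
    rw [hp, smul_mul_assoc, TensorProduct.tmul_smul, map_smul]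
    rcases Nat.even_or_odd (m * n) with he | he <;>
      simp [he.neg_one_pow]

theorem skew_mul_zero (a a' : Γ.carrier) {b : Θ.carrier} (hb : b ∈ Θ.grading 0)
    (b' : Θ.carrier) :
    toSkew Γ Θ (a ⊗ₜ b) * toSkew Γ Θ (a' ⊗ₜ b') = toSkew Γ Θ ((a * a') ⊗ₜ (b * b')) := by
  induction a' using Γ.induction_homogeneous with
  | add c d hc hd => simp only [TensorProduct.add_tmul, map_add, mul_add, hc, hd]
  | hom n a' ha' =>
    have hp : (Θ.parity ^ n) b = b := by
      clear ha'
      induction n with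
      | zero => simp
      | succ n ih => rw [pow_succ', Module.End.mul_apply, ih, Θ.parity_of_mem hb]; simp
    rw [skew_mul Γ Θ a b ha' b', hp]

variable {Θ} in
theorem skewCoact_mul (c : RightCovariant Θ) (x y : Skew Γ Θ) :
    skewCoact Γ c (x * y) = skewCoact Γ c x * skewCoact Γ c y := by
  have hc (a : Γ.carrier) (b : Θ.carrier) : skewCoact Γ c (toSkew Γ Θ (a ⊗ₜ b)) =
      (toSkew Γ Θ).toLinearMap.rTensor H
        ((TensorProduct.assoc ℂ Γ.carrier Θ.carrier H).symm (a ⊗ₜ c.coact b)) := rfl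
  have key (n : ℕ) (a a' : Γ.carrier) (ha' : a' ∈ Γ.grading n) (t t' : Θ.carrier ⊗[ℂ] H) :
      (toSkew Γ Θ).toLinearMap.rTensor H ((TensorProduct.assoc ℂ Γ.carrier Θ.carrier H).symm
        ((a * a') ⊗ₜ ((Θ.parity ^ n).rTensor H t * t'))) =
      (toSkew Γ Θ).toLinearMap.rTensor H
        ((TensorProduct.assoc ℂ Γ.carrier Θ.carrier H).symm (a ⊗ₜ t)) *
      (toSkew Γ Θ).toLinearMap.rTensor H
        ((TensorProduct.assoc ℂ Γ.carrier Θ.carrier H).symm (a' ⊗ₜ t')) := by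
    induction t with
    | zero => simp
    | add s t hs ht => simp only [map_add, add_mul, TensorProduct.tmul_add, hs, ht]
    | tmul b h =>
      induction t' with
      | zero => simp
      | add s t hs ht => simp only [map_add, mul_add, TensorProduct.tmul_add, hs, ht]
      | tmul b' h' =>
        simp only [LinearMap.rTensor_tmul, Algebra.TensorProduct.tmul_mul_tmul,
          TensorProduct.assoc_symm_tmul, LinearEquiv.coe_coe]
        rw [skew_mul Γ Θ a b ha' b']
  have hpow (n : ℕ) (b : Θ.carrier) :
      c.coact ((Θ.parity ^ n) b) = (Θ.parity ^ n).rTensor H (c.coact b) := by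
    induction n with
    | zero =>
      rw [pow_zero, Module.End.one_apply, Module.End.one_eq_id, LinearMap.rTensor_id,
        LinearMap.id_apply]
    | succ n ih =>
      rw [pow_succ', Module.End.mul_apply, coact_parity, ih, ← LinearMap.comp_apply,
        ← LinearMap.rTensor_comp]
      rfl
  induction x using skew_induction with
  | add x x' hx hx' => simp only [add_mul, map_add, hx, hx']
  | tmul a b =>
    induction y using skew_induction with
    | add y y' hy hy' => simp only [mul_add, map_add, hy, hy']
    | tmul a' b' =>
      induction a' using Γ.induction_homogeneous with
      | add a' a'' h h' => simp only [TensorProduct.add_tmul, map_add, mul_add, h, h']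
      | hom n a' ha' =>
        rw [skew_mul Γ Θ a b ha' b', hc, hc, hc, map_mul, hpow, key n a a' ha']

theorem skewIncl_mem_skewHor (t : A ⊗[ℂ] H) : skewIncl Γ Θ t ∈ skewHor Γ Θ := by
  refine ⟨_, ⟨Γ.incl.toLinearMap.rTensor H t, rfl⟩, ?_⟩
  rw [← LinearMap.comp_apply (Θ.incl.toLinearMap.lTensor Γ.carrier),
    LinearMap.lTensor_comp_rTensor]
  rfl

theorem skewHor_mul {x y : Skew Γ Θ} (hx : x ∈ skewHor Γ Θ) (hy : y ∈ skewHor Γ Θ) :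
    x * y ∈ skewHor Γ Θ := by
  obtain ⟨_, ⟨s, rfl⟩, rfl⟩ := hx
  obtain ⟨_, ⟨t, rfl⟩, rfl⟩ := hy
  induction s with
  | zero => simp
  | add s s' hs hs' => simp only [map_add, add_mul]; exact Submodule.add_mem _ hs hs'
  | tmul a h =>
    induction t with
    | zero => simp
    | add s s' hs hs' => simp only [map_add, mul_add]; exact Submodule.add_mem _ hs hs'
    | tmul a' h' =>
      refine ⟨_, ⟨(a * a') ⊗ₜ (h * h'), rfl⟩, ?_⟩
      simp only [LinearMap.lTensor_tmul, LinearEquiv.coe_coe, AlgHom.toLinearMap_apply]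
      rw [skew_mul_zero Γ Θ a a' (Θ.incl_mem h), map_mul]

/-- The embedding `γ ↦ γ ⊗̂ 1` of `Γ(A)` into `Γ(A) ⊗̂ Γ(H)`. -/
abbrev skewLeft : Γ.carrier →ₐ[ℂ] Skew Γ Θ := GradedTensorProduct.includeLeft Γ.grading Θ.grading

theorem skewLeft_apply (a : Γ.carrier) : skewLeft Γ Θ a = toSkew Γ Θ (a ⊗ₜ 1) := rfl

theorem skewLeft_mem_skewHor (a : Γ.carrier) : skewLeft Γ Θ a ∈ skewHor Γ Θ :=
  ⟨_, ⟨a ⊗ₜ 1, rfl⟩, by simp⟩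

theorem skewLeft_incl (a : A) : skewLeft Γ Θ (Γ.incl a) = skewIncl Γ Θ (a ⊗ₜ 1) := by
  simp [skewIncl]

theorem skewD_skewLeft (a : Γ.carrier) : skewD Γ Θ (skewLeft Γ Θ a) = skewLeft Γ Θ (Γ.d a) := by
  simp [skewD, Θ.d_one]

variable {Θ}

theorem skewCoact_skewIncl (c : RightCovariant Θ) (t : A ⊗[ℂ] H) :
    skewCoact Γ c (skewIncl Γ Θ t) = (skewIncl Γ Θ).rTensor H
      ((TensorProduct.assoc ℂ A H H).symm
        ((Coalgebra.comul (R := ℂ) (A := H)).lTensor A t)) := by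
  induction t with
  | zero => simp
  | add s t hs ht => simp only [map_add, hs, ht]
  | tmul a h =>
    simp only [skewCoact, skewIncl, LinearMap.comp_apply, LinearEquiv.coe_coe,
      LinearEquiv.symm_apply_apply, TensorProduct.map_tmul, LinearMap.lTensor_tmul,
      AlgHom.toLinearMap_apply, c.coact_incl]
    generalize Coalgebra.comul (R := ℂ) h = t
    induction t with
    | zero => simp
    | add s t hs ht => simp only [map_add, TensorProduct.tmul_add, hs, ht]
    | tmul h k => simp

theorem skewCoact_skewD_skewIncl (c : RightCovariant Θ) (t : A ⊗[ℂ] H) :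
    skewCoact Γ c (skewD Γ Θ (skewIncl Γ Θ t)) = (skewD Γ Θ ∘ₗ skewIncl Γ Θ).rTensor H
      ((TensorProduct.assoc ℂ A H H).symm
        ((Coalgebra.comul (R := ℂ) (A := H)).lTensor A t)) := by
  induction t with
  | zero => simp
  | add s t hs ht => simp only [map_add, hs, ht]
  | tmul a h =>
    simp only [skewCoact, skewIncl, skewD, LinearMap.comp_apply, LinearEquiv.coe_coe,
      LinearEquiv.symm_apply_apply, TensorProduct.map_tmul, LinearMap.lTensor_tmul,
      AlgHom.toLinearMap_apply, c.coact_incl, c.coact_d, LinearMap.add_apply, map_add,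
      LinearMap.id_apply]
    generalize Coalgebra.comul (R := ℂ) h = t
    induction t with
    | zero => simp
    | add s t hs ht =>
      simp only [map_add, TensorProduct.tmul_add] at hs ht ⊢
      rw [← hs, ← ht]
      abel
    | tmul h k => simp [TensorProduct.add_tmul]

/-- Evaluation of the second factor of a tensor product against a functional. -/
def slice (V : Type*) [AddCommGroup V] [Module ℂ V] (f : H →ₗ[ℂ] ℂ) : V ⊗[ℂ] H →ₗ[ℂ] V :=
  (TensorProduct.rid ℂ V).toLinearMap ∘ₗ f.lTensor V

theorem slice_rTensor {V W : Type*} [AddCommGroup V] [Module ℂ V] [AddCommGroup W] [Module ℂ W]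
    (f : H →ₗ[ℂ] ℂ) (g : V →ₗ[ℂ] W) (t : V ⊗[ℂ] H) :
    slice W f (g.rTensor H t) = g (slice V f t) := by
  induction t with
  | zero => simp
  | add s t hs ht => simp only [map_add, hs, ht]
  | tmul v h => simp [slice]

/-- An element of `V ⊗ H` all of whose slices lie in a subspace `W` of `V` belongs to `W ⊗ H`. -/
theorem mem_range_of_slice {V : Type*} [AddCommGroup V] [Module ℂ V] (W : Submodule ℂ V)
    (t : V ⊗[ℂ] H) (ht : ∀ f : H →ₗ[ℂ] ℂ, slice V f t ∈ W) :
    t ∈ LinearMap.range (W.subtype.rTensor H) := by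
  have hex : Function.Exact (W.subtype.rTensor H) (W.mkQ.rTensor H) :=
    rTensor_exact H (LinearMap.exact_subtype_mkQ W) W.mkQ_surjective
  refine (hex t).1 ?_
  have h0 (f : H →ₗ[ℂ] ℂ) : slice (V ⧸ W) f (W.mkQ.rTensor H t) = 0 := by
    rw [slice_rTensor]
    simpa using ht f
  generalize W.mkQ.rTensor H t = s at h0
  classical
  let b := Module.Basis.ofVectorSpace ℂ H
  apply (TensorProduct.equivFinsuppOfBasisRight b).injective
  rw [map_zero]
  ext i
  refine Eq.trans ?_ (h0 (b.coord i))
  clear h0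
  induction s with
  | zero => simp
  | add s t hs ht => simp only [map_add, Finsupp.add_apply, hs, ht]
  | tmul v h => simp [slice]

theorem slice_skewCoact_mem_skewHor (c : RightCovariant Θ) (f : H →ₗ[ℂ] ℂ) {x : Skew Γ Θ}
    (hx : x ∈ skewHor Γ Θ) : slice _ f (skewCoact Γ c x) ∈ skewHor Γ Θ := by
  obtain ⟨_, ⟨s, rfl⟩, rfl⟩ := hx
  induction s with
  | zero => simp
  | add s s' hs hs' => simp only [map_add]; exact Submodule.add_mem _ hs hs'
  | tmul a h =>
    simp only [skewCoact, LinearMap.comp_apply, LinearEquiv.coe_coe,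
      LinearEquiv.symm_apply_apply, LinearMap.lTensor_tmul,
      AlgHom.toLinearMap_apply, c.coact_incl]
    generalize Coalgebra.comul (R := ℂ) h = t
    induction t with
    | zero => simp
    | add s t hs ht =>
      simp only [map_add, TensorProduct.tmul_add]; exact Submodule.add_mem _ hs ht
    | tmul h k =>
      simp only [LinearMap.rTensor_tmul, TensorProduct.assoc_symm_tmul, slice,
        LinearMap.comp_apply, LinearMap.lTensor_tmul, LinearEquiv.coe_coe,
        TensorProduct.rid_tmul]
      exact Submodule.smul_mem _ _ ⟨_, ⟨a ⊗ₜ h, rfl⟩, rfl⟩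

end Skew

/-! ### Coverings -/

/-- A family of ideals of `A` is a complete covering if the intersection of the ideals vanishes and
`A` maps onto the gluing of the quotients `A/Jᵢ` along the `A/(Jᵢ + Jⱼ)`. -/
def IsCompleteCovering {I A : Type*} [Ring A] (J : I → Ideal A) : Prop :=
  ⨅ i, J i = ⊥ ∧
    ∀ b : I → A, (∀ i j, b i - b j ∈ J i ⊔ J j) → ∃ a, ∀ i, a - b i ∈ J i

section Completion

variable {I : Type*} {E : I → Type*} [∀ i, Ring (E i)] [∀ i, Algebra ℂ (E i)]

/-- The ideal of elements of `S ⊆ ∏ Eᵢ` whose `i`-th component vanishes. -/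
def coveringIdeal (S : Subalgebra ℂ (∀ i, E i)) (i : I) : Ideal S :=
  RingHom.ker ((Pi.evalAlgHom ℂ E i).comp S.val)

/-- The covering completion of an algebra `S ⊆ ∏ Eᵢ` that maps onto every `Eᵢ`, with respect to the
kernels `Kᵢ` of the projections to the `Eᵢ`. The quotient `S/Kᵢ` is identified with `Eᵢ`; the
families `(xᵢ)` belonging to the completion are those for which `xᵢ` and `xⱼ` agree in
`S/(Kᵢ + Kⱼ)`. -/
def coveringCompletion (S : Subalgebra ℂ (∀ i, E i)) : Subalgebra ℂ (∀ i, E i) where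
  carrier := {x | ∃ g : I → S, (∀ i, (g i : ∀ i, E i) i = x i) ∧
    ∀ i j, g i - g j ∈ coveringIdeal S i ⊔ coveringIdeal S j}
  mul_mem' := by
    rintro x y ⟨g, hg, hg'⟩ ⟨k, hk, hk'⟩
    refine ⟨fun i => g i * k i, fun i => by simp [hg, hk], fun i j => ?_⟩
    have h1 : (g i - g j) * k i ∈ coveringIdeal S i ⊔ coveringIdeal S j := by
      obtain ⟨a, ha, b, hb, hab⟩ := Submodule.mem_sup.1 (hg' i j)
      rw [← hab, add_mul]
      refine Submodule.add_mem_sup ?_ ?_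
      · rw [coveringIdeal, RingHom.mem_ker] at ha ⊢
        rw [map_mul, ha, zero_mul]
      · rw [coveringIdeal, RingHom.mem_ker] at hb ⊢
        rw [map_mul, hb, zero_mul]
    have h2 : g j * (k i - k j) ∈ coveringIdeal S i ⊔ coveringIdeal S j :=
      Ideal.mul_mem_left _ _ (hk' i j)
    have h3 : g i * k i - g j * k j = (g i - g j) * k i + g j * (k i - k j) := by
      rw [sub_mul, mul_sub]
      abel
    rw [h3]
    exact Ideal.add_mem _ h1 h2
  add_mem' := by
    rintro x y ⟨g, hg, hg'⟩ ⟨k, hk, hk'⟩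
    refine ⟨fun i => g i + k i, fun i => by simp [hg, hk], fun i j => ?_⟩
    rw [add_sub_add_comm]
    exact Ideal.add_mem _ (hg' i j) (hk' i j)
  algebraMap_mem' r := ⟨fun _ => algebraMap ℂ S r, fun _ => rfl, fun _ _ => by simp⟩

theorem le_coveringCompletion (S : Subalgebra ℂ (∀ i, E i)) : S ≤ coveringCompletion S :=
  fun x hx => ⟨fun _ => ⟨x, hx⟩, fun _ => rfl, fun _ _ => by simp⟩

end Completion

/-! ### Locally trivial quantum principal fibre bundles -/

/-- A locally trivial quantum principal fibre bundle with base `B`, structure group `H` and total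
space `P`. The index set of the covering is finite. -/
structure LocallyTrivialQPFB (I B H P : Type*) [Ring B] [Algebra ℂ B] [Ring H]
    [HopfAlgebra ℂ H] [Ring P] [Algebra ℂ P] where
  /-- the coaction `Δ_P` -/
  coaction : RightCoaction H P
  /-- the covering of the base -/
  J : I → Ideal B
  [twoSided : ∀ i, (J i).IsTwoSided]
  complete_base : IsCompleteCovering J
  /-- the local trivializations -/
  χ : ∀ i, P →ₐ[ℂ] (B ⧸ J i) ⊗[ℂ] H
  χ_surjective : ∀ i, Function.Surjective (χ i)
  /-- the embedding of the base -/
  ι : B →ₐ[ℂ] P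
  ι_injective : Function.Injective ι
  χ_coact : ∀ (i : I) (p : P),
    (Coalgebra.comul (R := ℂ) (A := H)).lTensor (B ⧸ J i) (χ i p) =
      TensorProduct.assoc ℂ (B ⧸ J i) H H ((χ i).toLinearMap.rTensor H (coaction.coact p))
  χ_ι : ∀ (i : I) (b : B), χ i (ι b) = Ideal.Quotient.mk (J i) b ⊗ₜ 1
  complete_total : IsCompleteCovering fun i => RingHom.ker (χ i)
  range_ι : ∀ p : P, p ∈ Set.range ι ↔ coaction.coact p = p ⊗ₜ 1

attribute [instance] LocallyTrivialQPFB.twoSided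

/-- The data determining a differential structure on a locally trivial bundle: differential calculi
`Γ(Bᵢ)` over the algebras `Bᵢ = B/Jᵢ`, and a right covariant differential calculus `Γ(H)`. -/
structure DifferentialStructure {I B H P : Type*} [Ring B] [Algebra ℂ B] [Ring H]
    [HopfAlgebra ℂ H] [Ring P] [Algebra ℂ P] (Q : LocallyTrivialQPFB I B H P) where
  calcB : ∀ i, DifferentialCalculus.{_, v} (B ⧸ Q.J i)
  calcH : DifferentialCalculus.{_, x} H
  covariant : RightCovariant calcH

namespace DifferentialStructure

variable {I B H P : Type*} [Ring B] [Algebra ℂ B] [Ring H]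
  [HopfAlgebra ℂ H] [Ring P] [Algebra ℂ P] {Q : LocallyTrivialQPFB I B H P}
  (G : DifferentialStructure Q)

/-- The local calculus `Γ(Bᵢ) ⊗̂ Γ(H)`. -/
abbrev Local (i : I) : Type _ := Skew (G.calcB i) G.calcH

/-- The direct sum of the local calculi. -/
abbrev Total : Type _ := ∀ i, G.Local i

/-- The differential on the direct sum of the local calculi. -/
def dTotal : G.Total →ₗ[ℂ] G.Total :=
  LinearMap.pi fun i => skewD (G.calcB i) G.calcH ∘ₗ LinearMap.proj i

/-- The map `p ↦ (χᵢ(p))ᵢ` from `P` to the direct sum of the local calculi. -/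
def χTotal : P →ₗ[ℂ] G.Total :=
  LinearMap.pi fun i => skewIncl (G.calcB i) G.calcH ∘ₗ (Q.χ i).toLinearMap

/-- The differential calculus `Γ(P) = Ω(P)/⋂ᵢ ker χᵢ`, where `χᵢ` here denotes the extension
`Ω(P) → Γ(Bᵢ) ⊗̂ Γ(H)` to the universal calculus. It is realized as the image of `Ω(P)` in the
direct sum of the local calculi under `(χᵢ)ᵢ`, the subalgebra generated by the images of all `p`
and `dp`. The extension of `χᵢ` to `Γ(P)` is the `i`-th projection. -/
def gammaP : Subalgebra ℂ G.Total :=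
  Algebra.adjoin ℂ (Set.range G.χTotal ∪ Set.range fun p => G.dTotal (G.χTotal p))

/-- The covering completion `Γ_c(P)`. -/
def gammaCP : Subalgebra ℂ G.Total := coveringCompletion G.gammaP

/-- The direct sum of the calculi `Γ(Bᵢ)`. -/
abbrev TotalB : Type _ := ∀ i, (G.calcB i).carrier

/-- The differential on the direct sum of the calculi `Γ(Bᵢ)`. -/
def dTotalB : G.TotalB →ₗ[ℂ] G.TotalB :=
  LinearMap.pi fun i => (G.calcB i).d ∘ₗ LinearMap.proj i

/-- The map `b ↦ (πᵢ(b))ᵢ` from `B` to the direct sum of the calculi `Γ(Bᵢ)`. -/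
def πTotal : B →ₗ[ℂ] G.TotalB :=
  LinearMap.pi fun i => (G.calcB i).incl.toLinearMap ∘ₗ (Ideal.Quotient.mkₐ ℂ (Q.J i)).toLinearMap

/-- The differential calculus `Γ(B) = Ω(B)/⋂ᵢ ker πᵢ`, realized as the image of `Ω(B)` in the
direct sum of the calculi `Γ(Bᵢ)`. -/
def gammaB : Subalgebra ℂ G.TotalB :=
  Algebra.adjoin ℂ (Set.range G.πTotal ∪ Set.range fun b => G.dTotalB (G.πTotal b))

/-- The covering completion `Γ_c(B)`. -/
def gammaCB : Subalgebra ℂ G.TotalB := coveringCompletion G.gammaB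

/-- The embedding `(γᵢ)ᵢ ↦ (γᵢ ⊗̂ 1)ᵢ`. -/
def embed : G.TotalB →ₐ[ℂ] G.Total :=
  AlgHom.pi fun i => (skewLeft (G.calcB i) G.calcH).comp (Pi.evalAlgHom ℂ _ i)

/-- The horizontal forms `hor Γ_c(P)`. -/
def hor : Subalgebra ℂ G.Total where
  carrier := {x | x ∈ G.gammaCP ∧ ∀ i, x i ∈ skewHor (G.calcB i) G.calcH}
  mul_mem' hx hy := ⟨mul_mem hx.1 hy.1, fun i => skewHor_mul _ _ (hx.2 i) (hy.2 i)⟩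
  add_mem' hx hy := ⟨add_mem hx.1 hy.1, fun i => Submodule.add_mem _ (hx.2 i) (hy.2 i)⟩
  algebraMap_mem' r := ⟨algebraMap_mem _ r, fun i => by
    have h := skewLeft_mem_skewHor (G.calcB i) G.calcH (algebraMap ℂ _ r)
    rwa [AlgHom.commutes] at h⟩

/-- The elements of degree `n` in the direct sum of the local calculi. -/
def HasDegree (n : ℕ) (x : G.Total) : Prop :=
  ∀ i, x i ∈ skewDegree (G.calcB i) G.calcH n

/-- The elements of degree `n` in the direct sum of the calculi `Γ(Bᵢ)`. -/
def HasDegreeB (n : ℕ) (x : G.TotalB) : Prop :=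
  ∀ i, x i ∈ (G.calcB i).grading n

theorem embed_mem_gammaP {x : G.TotalB} (hx : x ∈ G.gammaB) : G.embed x ∈ G.gammaP := by
  have h1 (b : B) : G.embed (G.πTotal b) = G.χTotal (Q.ι b) := by
    funext i
    change skewLeft _ _ ((G.calcB i).incl _) = skewIncl _ _ (Q.χ i (Q.ι b))
    rw [skewLeft_incl, Q.χ_ι]
    rfl
  have h2 (y : G.TotalB) : G.embed (G.dTotalB y) = G.dTotal (G.embed y) := by
    funext i
    exact (skewD_skewLeft _ _ _).symm
  have : G.gammaB ≤ G.gammaP.comap G.embed := by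
    refine Algebra.adjoin_le ?_
    rintro _ (⟨b, rfl⟩ | ⟨b, rfl⟩)
    · exact Algebra.subset_adjoin (Or.inl ⟨Q.ι b, (h1 b).symm⟩)
    · exact Algebra.subset_adjoin (Or.inr ⟨Q.ι b, by
        change G.dTotal (G.χTotal (Q.ι b)) = G.embed (G.dTotalB (G.πTotal b))
        rw [h2, h1]⟩)
  exact this hx

theorem embed_mem_hor {x : G.TotalB} (hx : x ∈ G.gammaCB) : G.embed x ∈ G.hor := by
  refine ⟨?_, fun i => skewLeft_mem_skewHor _ _ _⟩
  obtain ⟨g, hg, hg'⟩ := hx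
  refine ⟨fun i => ⟨G.embed (g i), G.embed_mem_gammaP (g i).2⟩, fun i => ?_, fun i j => ?_⟩
  · exact congrArg (skewLeft (G.calcB i) G.calcH) (hg i)
  · obtain ⟨a, ha, b, hb, hab⟩ := Submodule.mem_sup.1 (hg' i j)
    refine Submodule.mem_sup.2 ⟨⟨G.embed a, G.embed_mem_gammaP a.2⟩, ?_,
      ⟨G.embed b, G.embed_mem_gammaP b.2⟩, ?_, ?_⟩
    · have ha' : (a : G.TotalB) i = 0 := ha
      change skewLeft (G.calcB i) G.calcH ((a : G.TotalB) i) = 0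
      rw [ha', map_zero]
    · have hb' : (b : G.TotalB) j = 0 := hb
      change skewLeft (G.calcB j) G.calcH ((b : G.TotalB) j) = 0
      rw [hb', map_zero]
    · ext1
      change G.embed a + G.embed b = G.embed (g i) - G.embed (g j)
      rw [← map_add, ← map_sub]
      exact congrArg (fun z : G.gammaB => G.embed z) hab

/-- The embedding `ι_{Γ_c} : Γ_c(B) → hor Γ_c(P)`. -/
def embedHor (γ : G.gammaCB) : G.hor := ⟨G.embed γ, G.embed_mem_hor γ.2⟩

/-- The inclusion of `hor Γ_c(P)` into the direct sum of the local calculi. -/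
def horIncl : G.hor →ₗ[ℂ] G.Total := G.hor.val.toLinearMap

theorem horIncl_rTensor_injective : Function.Injective (G.horIncl.rTensor H) :=
  Module.Flat.rTensor_preserves_injective_linearMap _ Subtype.val_injective

section Coaction

variable [Fintype I] [DecidableEq I]

/-- The coaction `(γᵢ)ᵢ ↦ ((id ⊗ Δ^Γ)(γᵢ))ᵢ` on the direct sum of the local calculi. -/
def coactTotal : G.Total →ₗ[ℂ] G.Total ⊗[ℂ] H :=
  ∑ i, (LinearMap.single ℂ G.Local i).rTensor H ∘ₗ
    skewCoact (G.calcB i) G.covariant ∘ₗ LinearMap.proj i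

theorem slice_coactTotal (f : H →ₗ[ℂ] ℂ) (x : G.Total) (i : I) :
    slice _ f (G.coactTotal x) i = slice _ f (skewCoact (G.calcB i) G.covariant (x i)) := by
  simp only [coactTotal, LinearMap.sum_apply, LinearMap.comp_apply, map_sum, slice_rTensor,
    Finset.sum_apply, LinearMap.proj_apply, LinearMap.single_apply]
  rw [Finset.sum_eq_single i]
  · simp
  · intro j _ hj
    exact Pi.single_eq_of_ne hj.symm _
  · simp

theorem slice_mem_gammaP (f : H →ₗ[ℂ] ℂ) {x : G.Total} (hx : x ∈ G.gammaP) :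
    slice _ f (G.coactTotal x) ∈ G.gammaP := by
  have key : ∃ t : G.gammaP ⊗[ℂ] H, ∀ i, Algebra.TensorProduct.map
      ((Pi.evalAlgHom ℂ G.Local i).comp G.gammaP.val) (AlgHom.id ℂ H) t =
        skewCoact (G.calcB i) G.covariant (x i) := by
    have hgen (u : P →ₗ[ℂ] G.gammaP) (p : P)
        (hu : ∀ i, skewCoact (G.calcB i) G.covariant ((u p : G.Total) i) =
          (LinearMap.proj i ∘ₗ G.gammaP.val.toLinearMap ∘ₗ u).rTensor H (Q.coaction.coact p)) :
        ∃ t : G.gammaP ⊗[ℂ] H, ∀ i, Algebra.TensorProduct.map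
          ((Pi.evalAlgHom ℂ G.Local i).comp G.gammaP.val) (AlgHom.id ℂ H) t =
            skewCoact (G.calcB i) G.covariant ((u p : G.Total) i) := by
      refine ⟨u.rTensor H (Q.coaction.coact p), fun i => ?_⟩
      rw [hu i]
      generalize Q.coaction.coact p = t
      induction t with
      | zero => simp
      | add s t hs ht => simp only [map_add, hs, ht]
      | tmul p h => simp
    have hχ (i : I) (p : P) : (TensorProduct.assoc ℂ (B ⧸ Q.J i) H H).symm
        ((Coalgebra.comul (R := ℂ) (A := H)).lTensor (B ⧸ Q.J i) (Q.χ i p)) =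
          (Q.χ i).toLinearMap.rTensor H (Q.coaction.coact p) := by
      rw [Q.χ_coact, LinearEquiv.symm_apply_apply]
    induction hx using Algebra.adjoin_induction with
    | mem x hx =>
      obtain ⟨p, rfl⟩ | ⟨p, rfl⟩ := hx
      · refine hgen (LinearMap.codRestrict (Subalgebra.toSubmodule G.gammaP) G.χTotal
          fun p => Algebra.subset_adjoin (Or.inl ⟨p, rfl⟩)) p fun i => ?_
        refine (skewCoact_skewIncl _ G.covariant (Q.χ i p)).trans ?_
        rw [hχ, ← LinearMap.comp_apply, ← LinearMap.rTensor_comp]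
        rfl
      · refine hgen (LinearMap.codRestrict (Subalgebra.toSubmodule G.gammaP)
          (G.dTotal ∘ₗ G.χTotal) fun p => Algebra.subset_adjoin (Or.inr ⟨p, rfl⟩)) p fun i => ?_
        refine (skewCoact_skewD_skewIncl _ G.covariant (Q.χ i p)).trans ?_
        rw [hχ, ← LinearMap.comp_apply, ← LinearMap.rTensor_comp]
        rfl
    | algebraMap r =>
      refine ⟨algebraMap ℂ _ r, fun i => ?_⟩
      rw [AlgHom.commutes, Pi.algebraMap_apply, Algebra.algebraMap_eq_smul_one,
        Algebra.algebraMap_eq_smul_one, map_smul]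
      congr 1
      have h := skewCoact_skewIncl (G.calcB i) G.covariant (1 ⊗ₜ 1)
      have h1 : skewIncl (G.calcB i) G.calcH (1 ⊗ₜ 1) = 1 := by
        rw [← skewLeft_incl, map_one, map_one]
      rw [h1] at h
      rw [h]
      simp only [LinearMap.lTensor_tmul, Bialgebra.comul_one, Algebra.TensorProduct.one_def,
        TensorProduct.assoc_symm_tmul, LinearMap.rTensor_tmul, h1]
    | add x y _ _ hx hy =>
      obtain ⟨s, hs⟩ := hx
      obtain ⟨t, ht⟩ := hy
      exact ⟨s + t, fun i => by rw [map_add, hs, ht, Pi.add_apply, map_add]⟩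
    | mul x y _ _ hx hy =>
      obtain ⟨s, hs⟩ := hx
      obtain ⟨t, ht⟩ := hy
      exact ⟨s * t, fun i => by rw [map_mul, hs, ht, Pi.mul_apply, skewCoact_mul]⟩
  obtain ⟨t, ht⟩ := key
  have : slice _ f (G.coactTotal x) = (slice G.gammaP f t : G.gammaP) := by
    funext i
    rw [slice_coactTotal, ← ht i]
    exact slice_rTensor f ((Pi.evalAlgHom ℂ G.Local i).comp G.gammaP.val).toLinearMap t
  rw [this]
  exact Subtype.coe_prop _

theorem slice_mem_hor (f : H →ₗ[ℂ] ℂ) {x : G.Total} (hx : x ∈ G.hor) :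
    slice _ f (G.coactTotal x) ∈ G.hor := by
  refine ⟨?_, fun i => ?_⟩
  · obtain ⟨g, hg, hg'⟩ := hx.1
    refine ⟨fun i => ⟨_, G.slice_mem_gammaP f (g i).2⟩, fun i => ?_, fun i j => ?_⟩
    · refine (G.slice_coactTotal f _ i).trans ?_
      rw [slice_coactTotal, hg]
    · obtain ⟨a, ha, b, hb, hab⟩ := Submodule.mem_sup.1 (hg' i j)
      refine Submodule.mem_sup.2 ⟨⟨_, G.slice_mem_gammaP f a.2⟩, ?_,
        ⟨_, G.slice_mem_gammaP f b.2⟩, ?_, ?_⟩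
      · have ha' : (a : G.Total) i = 0 := ha
        change slice _ f (G.coactTotal (a : G.Total)) i = 0
        rw [slice_coactTotal, ha', map_zero, map_zero]
      · have hb' : (b : G.Total) j = 0 := hb
        change slice _ f (G.coactTotal (b : G.Total)) j = 0
        rw [slice_coactTotal, hb', map_zero, map_zero]
      · ext1
        change slice _ f (G.coactTotal a) + slice _ f (G.coactTotal b) =
          slice _ f (G.coactTotal (g i)) - slice _ f (G.coactTotal (g j))
        rw [← map_add, ← map_add, ← map_sub, ← map_sub]
        exact congrArg (fun z : G.gammaP => slice _ f (G.coactTotal z)) hab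
  · rw [slice_coactTotal]
    exact slice_skewCoact_mem_skewHor _ _ f (hx.2 i)

/-- The coaction `hor Γ_c(P) → hor Γ_c(P) ⊗ H`, the restriction of `coactTotal`. -/
def coactHor : G.hor →ₗ[ℂ] G.hor ⊗[ℂ] H :=
  (LinearEquiv.ofInjective _ G.horIncl_rTensor_injective).symm.toLinearMap ∘ₗ
    LinearMap.codRestrict _ (G.coactTotal ∘ₗ G.horIncl) fun x =>
      mem_range_of_slice (Subalgebra.toSubmodule G.hor) _ fun f => G.slice_mem_hor f x.2

theorem coactHor_eq (α : G.hor) : G.horIncl.rTensor H (G.coactHor α) = G.coactTotal α := by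
  have h := LinearEquiv.apply_symm_apply
    (LinearEquiv.ofInjective _ (G.horIncl_rTensor_injective (H := H)))
    (LinearMap.codRestrict _ (G.coactTotal ∘ₗ G.horIncl) (fun x =>
      mem_range_of_slice (Subalgebra.toSubmodule G.hor) _ fun f => G.slice_mem_hor f x.2) α)
  exact congrArg Subtype.val h

/-! ### Covariant derivatives, pre-connection forms and curvature -/

/-- The conditions common to left and right covariant derivatives on `hor Γ_c(P)`. -/
structure IsCovariantDerivativeBase (D : G.hor →ₗ[ℂ] G.hor) : Prop where
  degree : ∀ (n : ℕ) (α : G.hor), G.HasDegree n α → G.HasDegree (n + 1) (D α)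
  map_one : D 1 = 0
  covariant : ∀ α : G.hor, D.rTensor H (G.coactHor α) = G.coactHor (D α)
  localized : ∀ (i : I) (α : G.hor), (α : G.Total) i = 0 → (D α : G.Total) i = 0

/-- Left covariant derivatives on `hor Γ_c(P)`. -/
structure IsLeftCovariantDerivative (D : G.hor →ₗ[ℂ] G.hor) : Prop
    extends G.IsCovariantDerivativeBase D where
  leibniz : ∀ (n : ℕ) (γ : G.gammaCB) (α : G.hor), G.HasDegreeB n γ →
    (D (G.embedHor γ * α) : G.Total) =
      G.dTotal (G.embed γ) * α + (-1 : ℂ) ^ n • (G.embed γ * D α)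

/-- Right covariant derivatives on `hor Γ_c(P)`. -/
structure IsRightCovariantDerivative (D : G.hor →ₗ[ℂ] G.hor) : Prop
    extends G.IsCovariantDerivativeBase D where
  leibniz : ∀ (n : ℕ) (γ : G.gammaCB) (α : G.hor), G.HasDegree n α →
    (D (α * G.embedHor γ) : G.Total) =
      D α * G.embed γ + (-1 : ℂ) ^ n • (α * G.dTotal (G.embed γ))

/-- A linear map `ω : H → Γ_c(P)`, viewed as a map to the direct sum of the local calculi. -/
def toTotal (ω : H →ₗ[ℂ] G.gammaCP) : H →ₗ[ℂ] G.Total := G.gammaCP.val.toLinearMap ∘ₗ ω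

/-- Left pre-connection forms. -/
structure IsLeftPreConnectionForm (ω : H →ₗ[ℂ] G.gammaCP) : Prop where
  degree : ∀ h : H, G.HasDegree 1 (ω h)
  map_one : ω 1 = 0
  covariant : ∀ h : H, G.coactTotal (ω h) = (G.toTotal ω).rTensor H (adLeft h)
  vertical : ∀ (i : I) (h : H),
    (ω h : G.Total) i - horCanonical (G.calcB i) G.calcH ((ω h : G.Total) i) =
      - toSkew (G.calcB i) G.calcH (1 ⊗ₜ maurerCartanLeft G.calcH h)

/-- Right pre-connection forms. -/
structure IsRightPreConnectionForm (hS : Function.Bijective (HopfAlgebra.antipode ℂ (A := H)))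
    (ω : H →ₗ[ℂ] G.gammaCP) : Prop where
  degree : ∀ h : H, G.HasDegree 1 (ω h)
  map_one : ω 1 = 0
  covariant : ∀ h : H, G.coactTotal (ω h) = (G.toTotal ω).rTensor H (adRight hS h)
  vertical : ∀ (i : I) (h : H),
    (ω h : G.Total) i - horCanonical (G.calcB i) G.calcH ((ω h : G.Total) i) =
      - toSkew (G.calcB i) G.calcH (1 ⊗ₜ maurerCartanRight G.calcH hS h)

end Coaction

/-- The local form `Aᵢ(h) = -(id ⊗ ε) hor_c (χᵢ(ω(h)))` of a pre-connection form `ω`. -/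
def localForm (ω : H →ₗ[ℂ] G.gammaCP) (i : I) : H →ₗ[ℂ] (G.calcB i).carrier :=
  -(idCounit (G.calcB i) G.calcH ∘ₗ horCanonical (G.calcB i) G.calcH ∘ₗ LinearMap.proj i ∘ₗ
    G.toTotal ω)

/-- `A = Aᵢ` is the `i`-th local form of the covariant derivative `D`, that is,
`Aᵢ(h) = -(id ⊗ ε)(Dᵢ(1 ⊗ h))`, where the map `Dᵢ` on `Γ(Bᵢ) ⊗̂ H` is defined by
`Dᵢ ∘ χᵢ = χᵢ ∘ D`. -/
def IsLocalForm (D : G.hor →ₗ[ℂ] G.hor) (i : I) (A : H →ₗ[ℂ] (G.calcB i).carrier) : Prop :=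
  ∀ (h : H) (α : G.hor), (α : G.Total) i = skewIncl (G.calcB i) G.calcH (1 ⊗ₜ h) →
    A h = -idCounit (G.calcB i) G.calcH ((D α : G.Total) i)

/-- `ω` and the covariant derivative `D` belong to each other: they have the same local forms. -/
def Corresponds (ω : H →ₗ[ℂ] G.gammaCP) (D : G.hor →ₗ[ℂ] G.hor) : Prop :=
  ∀ i, G.IsLocalForm D i (G.localForm ω i)

/-- The left curvature form `Ω_l(h) = dω_l(h) - ∑ ω_l(h₁) ω_l(h₂)`. -/
def leftCurvatureForm (ω : H →ₗ[ℂ] G.gammaCP) : H →ₗ[ℂ] G.Total :=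
  G.dTotal ∘ₗ G.toTotal ω -
    LinearMap.mul' ℂ G.Total ∘ₗ TensorProduct.map (G.toTotal ω) (G.toTotal ω) ∘ₗ
      Coalgebra.comul (R := ℂ)

/-- The right curvature form `Ω_r(h) = dω_r(h) + ∑ ω_r(h₂) ω_r(h₁)`. -/
def rightCurvatureForm (ω : H →ₗ[ℂ] G.gammaCP) : H →ₗ[ℂ] G.Total :=
  G.dTotal ∘ₗ G.toTotal ω +
    LinearMap.mul' ℂ G.Total ∘ₗ TensorProduct.map (G.toTotal ω) (G.toTotal ω) ∘ₗ
      (TensorProduct.comm ℂ H H).toLinearMap ∘ₗ Coalgebra.comul (R := ℂ)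

/-- `α ⊗ h ↦ α Ω(h)`. -/
def mulRight (Ω : H →ₗ[ℂ] G.Total) : G.hor ⊗[ℂ] H →ₗ[ℂ] G.Total :=
  LinearMap.mul' ℂ G.Total ∘ₗ TensorProduct.map G.hor.val.toLinearMap Ω

/-- `α ⊗ h ↦ Ω(h) α`. -/
def mulLeft (Ω : H →ₗ[ℂ] G.Total) : G.hor ⊗[ℂ] H →ₗ[ℂ] G.Total :=
  LinearMap.mul' ℂ G.Total ∘ₗ TensorProduct.map Ω G.hor.val.toLinearMap ∘ₗ
    (TensorProduct.comm ℂ G.hor H).toLinearMap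

end DifferentialStructure

end QPFB

end

/-!
Locally, a covariant derivative is an operator `E` on `Γ(Bᵢ) ⊗̂ H` which is a derivation over
`L = Γ(Bᵢ)`, so it is determined by its values on the fiber `j : h ↦ 1 ⊗̂ h`. Covariance forces
`E j = -(a * j)` for the convolution product, where `a` is the local connection form, and hence
`E² j = -(d a + a * a) * j`. On the other hand, multiplying the defining properties of a
pre-connection form `ω` by `j` cancels the antipode and gives `j * ω = -(a * j + d j)`: the form `ω`
is the gauge transform of `-a` by `j`, so its curvature `Ω = d ω - ω * ω` satisfies
`j * Ω = -(d a + a * a) * j`. Since `E²` is linear over `L`, the two computations agree. The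
right-handed case is the left-handed one in the opposite algebra with the differential `d ∘ parity`.
-/

noncomputable section

namespace QPFB

open scoped Coalgebra
open WithConv MulOpposite

universe u v w x

/-- The differential of a differential superalgebra: `parity` is the grading involution and `d` an
odd derivation of square zero. -/
structure SuperDifferential (k R : Type*) [CommRing k] [Ring R] [Algebra k R] where
  parity : R →ₐ[k] R
  d : R →ₗ[k] R
  parity_parity (x : R) : parity (parity x) = x
  parity_d (x : R) : parity (d x) = -d (parity x)
  d_mul (x y : R) : d (x * y) = d x * y + parity x * d y
  d_d (x : R) : d (d x) = 0

section Convolution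

variable {k : Type*} [CommRing k] {C : Type*} [AddCommGroup C] [Module k C]
  {L R : Type*} [Ring L] [Algebra k L] [Ring R] [Algebra k R]

/-- The map `f ↦ op ∘ f` between convolution algebras with opposite targets. It turns a
convolution product into the one with respect to the opposite comultiplication. -/
def opConv : WithConv (C →ₗ[k] R) →ₗ[k] WithConv (C →ₗ[k] Rᵐᵒᵖ) where
  toFun f := toConv ((opLinearEquiv k).toLinearMap ∘ₗ f.ofConv)
  map_add' f g := by ext; simp
  map_smul' r f := by ext; simp

@[simp]
theorem opConv_apply (f : WithConv (C →ₗ[k] R)) (c : C) : opConv f c = op (f c) := rfl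

variable [Coalgebra k C]

variable (C) in
/-- Composition with an algebra homomorphism, as a homomorphism of convolution algebras. -/
def convMap (ι : L →ₐ[k] R) : WithConv (C →ₗ[k] L) →ₐ[k] WithConv (C →ₗ[k] R) :=
  AlgHom.ofLinearMap
    { toFun := fun f => toConv (ι.toLinearMap ∘ₗ f.ofConv)
      map_add' := fun f g => by ext; simp
      map_smul' := fun r f => by ext; simp }
    (by ext; simp [LinearMap.convOne_def])
    fun f g => congrArg toConv (LinearMap.algHom_comp_convMul_distrib ι f g)

@[simp]
theorem convMap_apply (ι : L →ₐ[k] R) (f : WithConv (C →ₗ[k] L)) (c : C) :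
    convMap C ι f c = ι (f c) := rfl

theorem opConv_mul_of_commute {f g : WithConv (C →ₗ[k] R)}
    (h : ∀ x y, Commute (f x) (g y)) : opConv f * opConv g = opConv (f * g) := by
  ext c
  simp [(ℛ k c).convMul_apply, ← op_mul, (h _ _).eq]

end Convolution

namespace SuperDifferential

variable {k : Type*} [CommRing k] {L R : Type*} [Ring L] [Algebra k L] [Ring R] [Algebra k R]

/-- The convolution algebra of linear maps from a coalgebra into a differential superalgebra, with
parity and differential taken pointwise. -/
def conv (δ : SuperDifferential k R) (C : Type*) [AddCommGroup C] [Module k C] [Coalgebra k C] :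
    SuperDifferential k (WithConv (C →ₗ[k] R)) where
  parity := convMap C δ.parity
  d :=
    { toFun := fun f => toConv (δ.d ∘ₗ f.ofConv)
      map_add' := fun f g => by ext; simp
      map_smul' := fun r f => by ext; simp }
  parity_parity f := by ext c; exact δ.parity_parity (f c)
  parity_d f := by ext c; exact δ.parity_d (f c)
  d_mul f g := by
    ext c
    simp [(ℛ k c).convMul_apply, δ.d_mul, Finset.sum_add_distrib]
  d_d f := by ext c; exact δ.d_d (f c)

@[simp]
theorem conv_parity_apply (δ : SuperDifferential k R) {C : Type*} [AddCommGroup C] [Module k C]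
    [Coalgebra k C] (f : WithConv (C →ₗ[k] R)) (c : C) :
    (δ.conv C).parity f c = δ.parity (f c) := rfl

@[simp]
theorem conv_d_apply (δ : SuperDifferential k R) {C : Type*} [AddCommGroup C] [Module k C]
    [Coalgebra k C] (f : WithConv (C →ₗ[k] R)) (c : C) : (δ.conv C).d f c = δ.d (f c) := rfl

/-- The opposite of a differential superalgebra. Its differential is `d ∘ parity`, since `d` itself
is a derivation of the opposite algebra only from the wrong side. -/
def opposite (δ : SuperDifferential k R) : SuperDifferential k Rᵐᵒᵖ where
  parity := δ.parity.op
  d := (opLinearEquiv k).toLinearMap ∘ₗ δ.d ∘ₗ δ.parity.toLinearMap ∘ₗ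
    (opLinearEquiv k).symm.toLinearMap
  parity_parity x := unop_injective (by simp [δ.parity_parity])
  parity_d x := unop_injective (by simp [δ.parity_d])
  d_mul x y := unop_injective (by simp [δ.d_mul, δ.parity_parity, add_comm])
  d_d x := unop_injective (by simp [δ.parity_d, δ.d_d])

theorem mul_curvature (δ : SuperDifferential k R) {j a ω : R} (hj : δ.parity j = j)
    (ha : δ.parity a = -a) (hω : j * ω = -(a * j + δ.d j)) :
    j * (δ.d ω - ω * ω) = -((δ.d a + a * a) * j) := by
  have hd : δ.d j * ω + j * δ.d ω = -(δ.d a * j - a * δ.d j) := by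
    simpa [δ.d_mul, hj, ha, δ.d_d, sub_eq_add_neg] using congrArg δ.d hω
  have hωω : j * ω * ω = -(a * (j * ω)) - δ.d j * ω := by
    conv_lhs => rw [hω]
    noncomm_ring
  calc j * (δ.d ω - ω * ω)
    _ = (δ.d j * ω + j * δ.d ω) - δ.d j * ω - j * ω * ω := by noncomm_ring
    _ = -(δ.d a * j - a * δ.d j) + a * (j * ω) := by rw [hd, hωω]; abel
    _ = -((δ.d a + a * a) * j) := by rw [hω]; noncomm_ring

theorem parity_convMap {C : Type*} [AddCommGroup C] [Module k C] [Coalgebra k C]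
    {δL : SuperDifferential k L} {δ : SuperDifferential k R} {ι : L →ₐ[k] R}
    (hι : ∀ x, ι (δL.parity x) = δ.parity (ι x)) {a : WithConv (C →ₗ[k] L)}
    (ha : (δL.conv C).parity a = -a) : (δ.conv C).parity (convMap C ι a) = -convMap C ι a := by
  rw [← map_neg, ← ha]
  ext c
  exact (hι (a c)).symm

section Square

variable {C : Type*} [AddCommGroup C] [Module k C] [Coalgebra k C]
  {δL : SuperDifferential k L} {δ : SuperDifferential k R} {ι : L →ₐ[k] R} {E : R →ₗ[k] R}
  {j ω : WithConv (C →ₗ[k] R)} {a : WithConv (C →ₗ[k] L)}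

theorem apply_mul_conv
    (hE : ∀ x c, E (ι x * j c) = ι (δL.d x) * j c + ι (δL.parity x) * E (j c))
    (x : L) (b : WithConv (C →ₗ[k] L)) (c : C) :
    E (ι x * (convMap C ι b * j) c) = ι (δL.d x) * (convMap C ι b * j) c +
      ι (δL.parity x) * (convMap C ι ((δL.conv C).d b) * j +
        convMap C ι ((δL.conv C).parity b) * toConv (E ∘ₗ j.ofConv)) c := by
  simp [(ℛ k c).convMul_apply, Finset.mul_sum, ← mul_assoc, ← map_mul, hE, δL.d_mul, add_mul,
    mul_add, Finset.sum_add_distrib, add_assoc]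

theorem sq_apply_mul
    (hιd : ∀ x, ι (δL.d x) = δ.d (ι x)) (hισ : ∀ x, ι (δL.parity x) = δ.parity (ι x))
    (hE : ∀ x c, E (ι x * j c) = ι (δL.d x) * j c + ι (δL.parity x) * E (j c))
    (hEj : toConv (E ∘ₗ j.ofConv) = -(convMap C ι a * j))
    (hj : (δ.conv C).parity j = j) (ha : (δL.conv C).parity a = -a)
    (hω : j * ω = -(convMap C ι a * j + (δ.conv C).d j)) (x : L) (c : C) :
    E (E (ι x * j c)) = ι x * (j * ((δ.conv C).d ω - ω * ω)) c := by
  have hEj' (c : C) : E (j c) = -(convMap C ι a * j) c := congrArg (fun f => f.ofConv c) hEj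
  have hda : convMap C ι ((δL.conv C).d a) = (δ.conv C).d (convMap C ι a) := by
    ext c; exact hιd (a c)
  have hσa := parity_convMap hισ ha
  have hEa : E (ι (δL.parity x) * (convMap C ι a * j) c) =
      ι (δL.d (δL.parity x)) * (convMap C ι a * j) c +
        ι x * (((δ.conv C).d (convMap C ι a) + convMap C ι a * convMap C ι a) * j) c := by
    rw [apply_mul_conv hE, δL.parity_parity, hEj, hda, ha, map_neg, neg_mul_neg, add_mul, mul_assoc]
  rw [(δ.conv C).mul_curvature hj hσa hω]
  simp [-LinearMap.convMul_apply, hE, hEj', hEa, δL.d_d, δL.parity_d]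

theorem parity_apply_neg {b : WithConv (C →ₗ[k] R)} (hEj : toConv (E ∘ₗ j.ofConv) = -(b * j))
    (hj : (δ.conv C).parity j = j) (hb : (δ.conv C).parity b = -b) (c : C) :
    δ.parity (E (j c)) = -E (j c) := by
  have hodd : (δ.conv C).parity (toConv (E ∘ₗ j.ofConv)) = -toConv (E ∘ₗ j.ofConv) := by
    rw [hEj, map_neg, map_mul, hb, hj, neg_mul]
  exact congrArg (fun f => f.ofConv c) hodd

theorem sq_apply_mul_op
    (hιd : ∀ x, ι (δL.d x) = δ.d (ι x)) (hισ : ∀ x, ι (δL.parity x) = δ.parity (ι x))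
    (hιj : ∀ x c, Commute (ι x) (j c))
    (hE : ∀ x c, E (j c * ι x) = E (j c) * ι x + j c * ι (δL.d x))
    (hEj : toConv (E ∘ₗ j.ofConv) = -(convMap C ι a * j))
    (hj : (δ.conv C).parity j = j) (ha : (δL.conv C).parity a = -a)
    (hω : opConv j * opConv ω = -(opConv (convMap C ι a) * opConv j + opConv ((δ.conv C).d j)))
    (hσω : (δ.conv C).parity ω = -ω) (x : L) (c : C) :
    E (E (j c * ι x)) =
      unop ((opConv j * (opConv ((δ.conv C).d ω) + opConv ω * opConv ω)) c) * ι x := by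
  have hj' (c : C) : δ.parity (j c) = j c := congrArg (fun f => f.ofConv c) hj
  have hσEj := parity_apply_neg hEj hj (parity_convMap hισ ha)
  let E' : Rᵐᵒᵖ →ₗ[k] Rᵐᵒᵖ := (opLinearEquiv k).toLinearMap ∘ₗ E ∘ₗ δ.parity.toLinearMap ∘ₗ
    (opLinearEquiv k).symm.toLinearMap
  have hE'E (x : L) : E' (E' (op (j c * ι x))) = -op (E (E (j c * ι x))) := by
    simp [E', hj', ← hισ, hE, hσEj, δL.parity_parity, δL.parity_d, add_comm]
  have hopa : convMap C ι.op (opConv a) = opConv (convMap C ι a) := rfl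
  have hcomm : opConv (convMap C ι a) * opConv j = opConv (convMap C ι a * j) :=
    opConv_mul_of_commute fun x y => hιj (a x) y
  have hd (f : WithConv (C →ₗ[k] R)) :
      (δ.opposite.conv C).d (opConv f) = opConv ((δ.conv C).d ((δ.conv C).parity f)) := rfl
  have key := sq_apply_mul (δL := δL.opposite) (δ := δ.opposite) (ι := ι.op) (E := E')
    (j := opConv j) (ω := opConv ω) (a := opConv a) (by simp [opposite, hιd, hισ])
    (by simp [opposite, hισ])
    (fun x c => by simp [opposite, E', hj', ← hισ, hE, add_comm])
    (by rw [hopa, hcomm, ← map_neg, ← hEj]; ext c; simp [E', hj'])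
    (congrArg opConv hj)
    ((congrArg opConv ha).trans (map_neg opConv a))
    (by rw [hω, hd, hj]; rfl) (op x) c
  rw [hd, hσω, map_neg, map_neg, ← neg_add', mul_neg] at key
  apply op_injective
  apply neg_injective
  rw [← hE'E]
  refine key.trans ?_
  exact mul_neg _ _

end Square

end SuperDifferential

section Antipode

variable {H R : Type*} [Ring H] [HopfAlgebra ℂ H] [Ring R] [Algebra ℂ R]

theorem conv_mul_antipode (j : H →ₐ[ℂ] R) :
    toConv j.toLinearMap * toConv (j.toLinearMap ∘ₗ HopfAlgebra.antipode ℂ) = 1 := by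
  have h := congrArg (convMap H j) LinearMap.id_mul_antipode
  rw [map_mul, map_one] at h
  exact h

theorem antipode_antipodeInv (hS : Function.Bijective (HopfAlgebra.antipode ℂ (A := H))) (h : H) :
    HopfAlgebra.antipode ℂ (antipodeInv hS h) = h :=
  LinearEquiv.apply_symm_apply (LinearEquiv.ofBijective _ hS) h

theorem opConv_id_mul_antipodeInv (hS : Function.Bijective (HopfAlgebra.antipode ℂ (A := H))) :
    opConv (toConv LinearMap.id) * opConv (toConv (antipodeInv hS)) = 1 := by
  ext h
  apply unop_injective
  apply hS.injective
  have := congrArg (fun f => f.ofConv h) (LinearMap.antipode_mul_id (R := ℂ) (C := H))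
  rw [(ℛ ℂ h).convMul_apply] at this ⊢
  simpa [HopfAlgebra.antipode_mul_antidistrib, antipode_antipodeInv, LinearMap.convOne_def,
    Algebra.algebraMap_eq_smul_one, HopfAlgebra.antipode_one] using this

theorem opConv_mul_antipodeInv (hS : Function.Bijective (HopfAlgebra.antipode ℂ (A := H)))
    (j : H →ₐ[ℂ] R) :
    opConv (toConv j.toLinearMap) * opConv (toConv (j.toLinearMap ∘ₗ antipodeInv hS)) = 1 := by
  have h := congrArg (convMap H j.op) (opConv_id_mul_antipodeInv hS)
  rw [map_mul, map_one] at h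
  exact h

theorem convMul_convMul_apply (f g h : WithConv (H →ₗ[ℂ] R)) (c : H) :
    (f * (g * h)) c =
      LinearMap.mul' ℂ R (TensorProduct.map f.ofConv
        (LinearMap.mul' ℂ R ∘ₗ TensorProduct.map g.ofConv h.ofConv) (comul₃ c)) := by
  rw [comul₃, LinearMap.comp_apply, ← LinearMap.comp_apply (TensorProduct.map _ _),
    LinearMap.lTensor, ← TensorProduct.map_comp]
  rfl

theorem mul'_map_adLeft {a : WithConv (H →ₗ[ℂ] R)} {j : H →ₐ[ℂ] R}
    (haj : ∀ x y, Commute (a x) (j y)) (h : H) :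
    LinearMap.mul' ℂ R (TensorProduct.map a.ofConv j.toLinearMap (adLeft h)) =
      (toConv (j.toLinearMap ∘ₗ HopfAlgebra.antipode ℂ) * (a * toConv j.toLinearMap)) h := by
  rw [convMul_convMul_apply]
  simp only [adLeft, LinearMap.comp_apply]
  generalize comul₃ h = t
  induction t with
  | zero => simp
  | add s t hs ht => simp only [map_add, hs, ht]
  | tmul x t =>
    induction t with
    | zero => simp
    | add s t hs ht => simp only [map_add, TensorProduct.tmul_add, hs, ht]
    | tmul u v => simp [← mul_assoc, (haj u (HopfAlgebra.antipode ℂ x)).eq]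

theorem mul'_map_adRight (hS : Function.Bijective (HopfAlgebra.antipode ℂ (A := H)))
    {a : WithConv (H →ₗ[ℂ] R)} {j : H →ₐ[ℂ] R} (haj : ∀ x y, Commute (a x) (j y)) (h : H) :
    LinearMap.mul' ℂ R (TensorProduct.map a.ofConv j.toLinearMap (adRight hS h)) =
      unop ((opConv (toConv (j.toLinearMap ∘ₗ antipodeInv hS)) *
        (opConv a * opConv (toConv j.toLinearMap))) h) := by
  rw [convMul_convMul_apply]
  simp only [adRight, LinearMap.comp_apply]
  generalize comul₃ h = t
  induction t with
  | zero => simp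
  | add s t hs ht => simp only [map_add, unop_add, hs, ht]
  | tmul x t =>
    induction t with
    | zero => simp
    | add s t hs ht => simp only [map_add, TensorProduct.tmul_add, unop_add, hs, ht]
    | tmul u v => simp [← mul_assoc, (haj u v).eq]

theorem conv_mul_eq_of_apply_eq_adLeft {a b ω : WithConv (H →ₗ[ℂ] R)} {j : H →ₐ[ℂ] R}
    (haj : ∀ x y, Commute (a x) (j y))
    (hω : ∀ h, ω h = -((toConv (j.toLinearMap ∘ₗ HopfAlgebra.antipode ℂ) * b) h +
      LinearMap.mul' ℂ R (TensorProduct.map a.ofConv j.toLinearMap (adLeft h)))) :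
    toConv j.toLinearMap * ω = -(a * toConv j.toLinearMap + b) := by
  have hgauge : ω = -(toConv (j.toLinearMap ∘ₗ HopfAlgebra.antipode ℂ) *
      (b + a * toConv j.toLinearMap)) := by
    ext h
    rw [mul_add]
    exact (hω h).trans (by rw [mul'_map_adLeft haj]; rfl)
  rw [hgauge, mul_neg, ← mul_assoc, conv_mul_antipode, one_mul, add_comm]

theorem opConv_mul_eq_of_apply_eq_adRight
    (hS : Function.Bijective (HopfAlgebra.antipode ℂ (A := H)))
    {a b ω : WithConv (H →ₗ[ℂ] R)} {j : H →ₐ[ℂ] R} (haj : ∀ x y, Commute (a x) (j y))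
    (hω : ∀ h, ω h = -(unop ((opConv (toConv (j.toLinearMap ∘ₗ antipodeInv hS)) * opConv b) h) +
      LinearMap.mul' ℂ R (TensorProduct.map a.ofConv j.toLinearMap (adRight hS h)))) :
    opConv (toConv j.toLinearMap) * opConv ω =
      -(opConv a * opConv (toConv j.toLinearMap) + opConv b) := by
  have hgauge : opConv ω = -(opConv (toConv (j.toLinearMap ∘ₗ antipodeInv hS)) *
      (opConv b + opConv a * opConv (toConv j.toLinearMap))) := by
    ext h
    apply unop_injective
    rw [mul_add]
    exact (hω h).trans (by rw [mul'_map_adRight hS haj]; rfl)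
  have hcancel := mul_neg (opConv (toConv j.toLinearMap))
    (opConv (toConv (j.toLinearMap ∘ₗ antipodeInv hS)) *
      (opConv b + opConv a * opConv (toConv j.toLinearMap)))
  rw [← mul_assoc, opConv_mul_antipodeInv, one_mul] at hcancel
  rw [hgauge, add_comm (opConv a * _)]
  exact hcancel

end Antipode

namespace DifferentialCalculus

variable {A : Type u} [Ring A] [Algebra ℂ A] (Γ : DifferentialCalculus.{u, v} A)

theorem parity_parity (a : Γ.carrier) : Γ.parity (Γ.parity a) = a := by
  induction a using Γ.induction_homogeneous with
  | add a b ha hb => rw [map_add, map_add, ha, hb]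
  | hom n a ha =>
    rw [Γ.parity_of_mem ha, map_smul, Γ.parity_of_mem ha, smul_smul, ← mul_pow]
    simp

theorem parity_d (a : Γ.carrier) : Γ.parity (Γ.d a) = -Γ.d (Γ.parity a) := by
  induction a using Γ.induction_homogeneous with
  | add a b ha hb => simp only [map_add, ha, hb, neg_add]
  | hom n a ha =>
    rw [Γ.parity_of_mem ha, Γ.parity_of_mem (Γ.d_mem _ _ ha), map_smul, pow_succ]
    simp

theorem d_mul (a b : Γ.carrier) : Γ.d (a * b) = Γ.d a * b + Γ.parity a * Γ.d b := by
  induction a using Γ.induction_homogeneous with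
  | add a a' ha ha' =>
    simp only [map_add, add_mul, ha, ha']
    abel
  | hom n a ha => rw [Γ.leibniz n a b ha, Γ.parity_of_mem ha, smul_mul_assoc]

theorem parity_mem {n : ℕ} {a : Γ.carrier} (ha : a ∈ Γ.grading n) : Γ.parity a ∈ Γ.grading n := by
  rw [Γ.parity_of_mem ha]
  exact Submodule.smul_mem _ _ ha

theorem parity_one : Γ.parity 1 = 1 := by
  simpa using Γ.parity_incl 1

theorem parity_parity_pow (n : ℕ) (a : Γ.carrier) :
    Γ.parity ((Γ.parity ^ n) a) = (Γ.parity ^ n) (Γ.parity a) := by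
  rw [← Module.End.mul_apply, ← Module.End.mul_apply, ← pow_succ, ← pow_succ']

theorem d_parity_pow (n : ℕ) (a : Γ.carrier) :
    Γ.d ((Γ.parity ^ n) a) = (-1 : ℂ) ^ n • (Γ.parity ^ n) (Γ.d a) := by
  induction n with
  | zero => simp
  | succ n ih =>
    rw [pow_succ', Module.End.mul_apply, Module.End.mul_apply,
      ← neg_neg (Γ.d (Γ.parity _)), ← Γ.parity_d, ih, map_smul, pow_succ']
    simp

/-- A differential calculus as a differential superalgebra, graded by the parity of degrees. -/
def superDifferential : SuperDifferential ℂ Γ.carrier where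
  parity := Γ.parityHom
  d := Γ.d
  parity_parity := Γ.parity_parity
  parity_d := Γ.parity_d
  d_mul := Γ.d_mul
  d_d := Γ.d_d

theorem projZero_of_mem {a : Γ.carrier} (ha : a ∈ Γ.grading 0) : Γ.projZero a = a :=
  DirectSum.decompose_of_mem_same _ ha

theorem projZero_of_mem_ne {n : ℕ} (hn : n ≠ 0) {a : Γ.carrier} (ha : a ∈ Γ.grading n) :
    Γ.projZero a = 0 :=
  DirectSum.decompose_of_mem_ne _ ha hn

theorem projZero_mul (a b : Γ.carrier) : Γ.projZero (a * b) = Γ.projZero a * Γ.projZero b :=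
  map_mul (GradedRing.projZeroRingHom Γ.grading) a b

/-- The projection onto the component of degree zero as a homomorphism of algebras. -/
def projZeroHom : Γ.carrier →ₐ[ℂ] Γ.carrier :=
  AlgHom.ofLinearMap Γ.projZero (Γ.projZero_of_mem (by simpa using Γ.incl_mem 1)) Γ.projZero_mul

theorem degreeZero_incl (a : A) : Γ.degreeZero (Γ.incl a) = a := by
  apply Γ.incl_injective
  have h := LinearEquiv.apply_symm_apply
    (LinearEquiv.ofInjective Γ.incl.toLinearMap Γ.incl_injective)
    (LinearMap.codRestrict _ Γ.projZero Γ.projZero_mem_range (Γ.incl a))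
  exact (congrArg Subtype.val h).trans (Γ.projZero_of_mem (Γ.incl_mem a))

theorem degreeZero_of_mem_ne {n : ℕ} (hn : n ≠ 0) {a : Γ.carrier} (ha : a ∈ Γ.grading n) :
    Γ.degreeZero a = 0 := by
  have h : LinearMap.codRestrict _ Γ.projZero Γ.projZero_mem_range a = 0 :=
    Subtype.ext (Γ.projZero_of_mem_ne hn ha)
  rw [degreeZero, LinearMap.comp_apply, h, map_zero]

end DifferentialCalculus

theorem coact_projZero {H : Type w} [Ring H] [HopfAlgebra ℂ H] {Γ : DifferentialCalculus.{w, v} H}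
    (c : RightCovariant Γ) (a : Γ.carrier) :
    c.coact (Γ.projZero a) = Γ.projZero.rTensor H (c.coact a) := by
  have key : c.coact.comp Γ.projZeroHom =
      (Algebra.TensorProduct.map Γ.projZeroHom (AlgHom.id ℂ H)).comp c.coact := by
    refine AlgHom.ext_of_adjoin_eq_top Γ.generated ?_
    rintro _ (⟨h, rfl⟩ | ⟨h, rfl⟩)
    · change c.coact (Γ.projZero (Γ.incl h)) = Γ.projZero.rTensor H (c.coact (Γ.incl h))
      rw [Γ.projZero_of_mem (Γ.incl_mem h), c.coact_incl,
        ← LinearMap.comp_apply (Γ.projZero.rTensor H), ← LinearMap.rTensor_comp]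
      congr 2
      ext a
      simp [Γ.projZero_of_mem (Γ.incl_mem a)]
    · have hp (a : H) : Γ.projZero (Γ.d (Γ.incl a)) = 0 :=
        Γ.projZero_of_mem_ne one_ne_zero (Γ.d_mem _ _ (Γ.incl_mem a))
      change c.coact (Γ.projZero (Γ.d (Γ.incl h))) =
        Γ.projZero.rTensor H (c.coact (Γ.d (Γ.incl h)))
      have h0 : Γ.projZero ∘ₗ Γ.d ∘ₗ Γ.incl.toLinearMap = 0 := LinearMap.ext hp
      rw [hp, map_zero, c.coact_d, ← LinearMap.comp_apply (Γ.projZero.rTensor H),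
        ← LinearMap.rTensor_comp, h0, LinearMap.rTensor_zero, LinearMap.zero_apply]
  exact DFunLike.congr_fun key a

section Skew

variable {A : Type u} [Ring A] [Algebra ℂ A] {H : Type w} [Ring H] [HopfAlgebra ℂ H]
  (Γ : DifferentialCalculus.{u, v} A) (Θ : DifferentialCalculus.{w, x} H)

/-- The grading involution of the skew tensor product. -/
def skewParity : Skew Γ Θ →ₗ[ℂ] Skew Γ Θ :=
  (toSkew Γ Θ).toLinearMap ∘ₗ TensorProduct.map Γ.parity Θ.parity ∘ₗ
    (toSkew Γ Θ).symm.toLinearMap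

theorem skewParity_tmul (a : Γ.carrier) (b : Θ.carrier) :
    skewParity Γ Θ (toSkew Γ Θ (a ⊗ₜ b)) = toSkew Γ Θ (Γ.parity a ⊗ₜ Θ.parity b) := rfl

theorem skewD_tmul (a : Γ.carrier) (b : Θ.carrier) :
    skewD Γ Θ (toSkew Γ Θ (a ⊗ₜ b)) =
      toSkew Γ Θ (Γ.d a ⊗ₜ b) + toSkew Γ Θ (Γ.parity a ⊗ₜ Θ.d b) := by
  rw [← map_add]
  rfl

theorem skewParity_mul (x y : Skew Γ Θ) :
    skewParity Γ Θ (x * y) = skewParity Γ Θ x * skewParity Γ Θ y := by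
  induction x using skew_induction with
  | add x x' hx hx' => simp only [add_mul, map_add, hx, hx']
  | tmul a b =>
    induction y using skew_induction with
    | add y y' hy hy' => simp only [mul_add, map_add, hy, hy']
    | tmul a' b' =>
      induction a' using Γ.induction_homogeneous with
      | add a' a'' h h' => simp only [TensorProduct.add_tmul, map_add, mul_add, h, h']
      | hom n a' ha' =>
        rw [skew_mul Γ Θ a b ha' b', skewParity_tmul, skewParity_tmul, skewParity_tmul,
          skew_mul Γ Θ _ _ (Γ.parity_mem ha') _, Γ.parity_mul, Θ.parity_mul, Θ.parity_parity_pow]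

theorem skewD_mul (x y : Skew Γ Θ) :
    skewD Γ Θ (x * y) = skewD Γ Θ x * y + skewParity Γ Θ x * skewD Γ Θ y := by
  induction x using skew_induction with
  | add x x' hx hx' =>
    simp only [add_mul, map_add, hx, hx']
    abel
  | tmul a b =>
    induction y using skew_induction with
    | add y y' hy hy' =>
      simp only [mul_add, map_add, hy, hy']
      abel
    | tmul a' b' =>
      induction a' using Γ.induction_homogeneous with
      | add a' a'' h h' =>
        simp only [TensorProduct.add_tmul, map_add, mul_add, h, h']
        abel
      | hom n a' ha' =>
        rw [skew_mul Γ Θ a b ha' b', skewD_tmul, skewD_tmul, skewD_tmul, skewParity_tmul, add_mul,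
          mul_add, skew_mul Γ Θ _ _ ha' _, skew_mul Γ Θ _ _ ha' _,
          skew_mul Γ Θ _ _ (Γ.d_mem _ _ ha') _, skew_mul Γ Θ _ _ (Γ.parity_mem ha') _,
          Γ.d_mul, Γ.parity_mul, Θ.d_mul, pow_succ, Module.End.mul_apply, Θ.parity_parity,
          Θ.d_parity_pow, Θ.parity_parity_pow, TensorProduct.add_tmul, TensorProduct.tmul_add,
          map_add, map_add, Γ.parity_of_mem ha', mul_smul_comm, smul_mul_assoc,
          TensorProduct.smul_tmul_smul, ← mul_pow, neg_one_mul, neg_neg, one_pow, one_smul]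
        abel

theorem skewD_skewD (x : Skew Γ Θ) : skewD Γ Θ (skewD Γ Θ x) = 0 := by
  induction x using skew_induction with
  | add x x' hx hx' => simp only [map_add, hx, hx', add_zero]
  | tmul a b =>
    simp [skewD_tmul, Γ.d_d, Θ.d_d, Γ.parity_d, TensorProduct.neg_tmul]

theorem skewParity_skewParity (x : Skew Γ Θ) : skewParity Γ Θ (skewParity Γ Θ x) = x := by
  induction x using skew_induction with
  | add x x' hx hx' => simp only [map_add, hx, hx']
  | tmul a b => simp only [skewParity_tmul, Γ.parity_parity, Θ.parity_parity]

theorem skewParity_skewD (x : Skew Γ Θ) :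
    skewParity Γ Θ (skewD Γ Θ x) = -skewD Γ Θ (skewParity Γ Θ x) := by
  induction x using skew_induction with
  | add x x' hx hx' => simp only [map_add, hx, hx', neg_add]
  | tmul a b =>
    simp only [skewParity_tmul, skewD_tmul, map_add, Γ.parity_d, Θ.parity_d,
      TensorProduct.neg_tmul, TensorProduct.tmul_neg, map_neg, neg_add]

/-- The skew tensor product as a differential superalgebra, graded by the parity of the total
degree. -/
def skewSuperDifferential : SuperDifferential ℂ (Skew Γ Θ) where
  parity := AlgHom.ofLinearMap (skewParity Γ Θ)
    (by
      change skewParity Γ Θ (toSkew Γ Θ (1 ⊗ₜ 1)) = toSkew Γ Θ (1 ⊗ₜ 1)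
      rw [skewParity_tmul, Γ.parity_one, Θ.parity_one])
    (skewParity_mul Γ Θ)
  d := skewD Γ Θ
  parity_parity := skewParity_skewParity Γ Θ
  parity_d := skewParity_skewD Γ Θ
  d_mul := skewD_mul Γ Θ
  d_d := skewD_skewD Γ Θ

theorem skewDegree_induction {n : ℕ} {p : Skew Γ Θ → Prop} {x : Skew Γ Θ}
    (hx : x ∈ skewDegree Γ Θ n)
    (tmul : ∀ (k l : ℕ) (a : Γ.carrier) (b : Θ.carrier), k + l = n → a ∈ Γ.grading k →
      b ∈ Θ.grading l → p (toSkew Γ Θ (a ⊗ₜ b)))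
    (zero : p 0) (add : ∀ x y, p x → p y → p (x + y)) : p x := by
  refine Submodule.iSup_induction _ (motive := p) hx ?_ zero add
  rintro ⟨⟨k, l⟩, hkl⟩ _ ⟨_, ⟨t, rfl⟩, rfl⟩
  induction t with
  | zero => simpa using zero
  | add s t hs ht => simp only [map_add]; exact add _ _ hs ht
  | tmul a b => exact tmul k l a b hkl a.2 b.2

theorem skewParity_of_mem {n : ℕ} {x : Skew Γ Θ} (hx : x ∈ skewDegree Γ Θ n) :
    skewParity Γ Θ x = (-1 : ℂ) ^ n • x := by
  refine skewDegree_induction Γ Θ (p := fun x => skewParity Γ Θ x = (-1 : ℂ) ^ n • x) hx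
    (fun k l a b hkl ha hb => ?_) (by simp) fun x y hx hy => by rw [map_add, hx, hy, smul_add]
  rw [skewParity_tmul, Γ.parity_of_mem ha, Θ.parity_of_mem hb, TensorProduct.smul_tmul_smul,
    map_smul, ← pow_add, hkl]

theorem idCounit_tmul (a : Γ.carrier) (b : Θ.carrier) :
    idCounit Γ Θ (toSkew Γ Θ (a ⊗ₜ b)) =
      Coalgebra.counit (R := ℂ) (A := H) (Θ.degreeZero b) • a := rfl

theorem idCounit_mem {n : ℕ} {x : Skew Γ Θ} (hx : x ∈ skewDegree Γ Θ n) :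
    idCounit Γ Θ x ∈ Γ.grading n := by
  refine skewDegree_induction Γ Θ (p := fun x => idCounit Γ Θ x ∈ Γ.grading n) hx
    (fun k l a b hkl ha hb => ?_) (by simp) fun x y hx hy => by
      rw [map_add]; exact Submodule.add_mem _ hx hy
  rw [idCounit_tmul]
  rcases eq_or_ne l 0 with rfl | hl
  · exact Submodule.smul_mem _ _ (by simpa [← hkl] using ha)
  · simp [Θ.degreeZero_of_mem_ne hl hb]

theorem skewIncl_mem_skewDegree (t : A ⊗[ℂ] H) : skewIncl Γ Θ t ∈ skewDegree Γ Θ 0 := by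
  induction t with
  | zero => simp
  | add s t hs ht => rw [map_add]; exact Submodule.add_mem _ hs ht
  | tmul a h =>
    refine Submodule.mem_iSup_of_mem ⟨(0, 0), rfl⟩ ?_
    exact ⟨_, ⟨⟨Γ.incl a, Γ.incl_mem a⟩ ⊗ₜ ⟨Θ.incl h, Θ.incl_mem h⟩, rfl⟩, rfl⟩

/-- The embedding `h ↦ 1 ⊗̂ h` of `H` into `Γ(A) ⊗̂ Γ(H)`. -/
def skewRight : H →ₐ[ℂ] Skew Γ Θ :=
  (GradedTensorProduct.includeRight Γ.grading Θ.grading).comp Θ.incl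

theorem skewRight_apply (h : H) : skewRight Γ Θ h = toSkew Γ Θ (1 ⊗ₜ Θ.incl h) := rfl

theorem skewIncl_one_tmul (h : H) : skewIncl Γ Θ (1 ⊗ₜ h) = skewRight Γ Θ h := by
  simp [skewIncl, skewRight_apply]

theorem skewLeft_mul_skewRight (a : Γ.carrier) (h : H) :
    skewLeft Γ Θ a * skewRight Γ Θ h = toSkew Γ Θ (a ⊗ₜ Θ.incl h) := by
  rw [skewLeft_apply, skewRight_apply, skew_mul_zero Γ Θ _ _ (by simpa using Θ.incl_mem 1),
    mul_one, one_mul]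

theorem skewRight_mul_skewLeft (a : Γ.carrier) (h : H) :
    skewRight Γ Θ h * skewLeft Γ Θ a = toSkew Γ Θ (a ⊗ₜ Θ.incl h) := by
  rw [skewLeft_apply, skewRight_apply, skew_mul_zero Γ Θ _ _ (Θ.incl_mem h), mul_one, one_mul]

theorem commute_skewLeft_skewRight (a : Γ.carrier) (h : H) :
    Commute (skewLeft Γ Θ a) (skewRight Γ Θ h) :=
  (skewLeft_mul_skewRight Γ Θ a h).trans (skewRight_mul_skewLeft Γ Θ a h).symm

theorem skewParity_skewLeft (a : Γ.carrier) :
    skewParity Γ Θ (skewLeft Γ Θ a) = skewLeft Γ Θ (Γ.parity a) := by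
  rw [skewLeft_apply, skewParity_tmul, Θ.parity_one, skewLeft_apply]

theorem skewParity_skewRight (h : H) :
    skewParity Γ Θ (skewRight Γ Θ h) = skewRight Γ Θ h := by
  rw [skewRight_apply, skewParity_tmul, Γ.parity_one, Θ.parity_incl]

theorem skewD_one_tmul (b : Θ.carrier) :
    skewD Γ Θ (toSkew Γ Θ (1 ⊗ₜ b)) = toSkew Γ Θ (1 ⊗ₜ Θ.d b) := by
  rw [skewD_tmul, Γ.d_one, Γ.parity_one, TensorProduct.zero_tmul, map_zero, zero_add]

theorem skewHor_induction {p : Skew Γ Θ → Prop} {x : Skew Γ Θ} (hx : x ∈ skewHor Γ Θ)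
    (mul : ∀ (a : Γ.carrier) (h : H), p (skewLeft Γ Θ a * skewRight Γ Θ h))
    (add : ∀ x y, p x → p y → p (x + y)) : p x := by
  obtain ⟨_, ⟨t, rfl⟩, rfl⟩ := hx
  induction t with
  | zero => simpa using mul 0 0
  | add s t hs ht => simp only [map_add]; exact add _ _ hs ht
  | tmul a h =>
    have := mul a h
    rwa [skewLeft_mul_skewRight] at this

theorem horCanonical_mem_skewHor (x : Skew Γ Θ) : horCanonical Γ Θ x ∈ skewHor Γ Θ := by
  induction x using skew_induction with
  | add x y hx hy => rw [map_add]; exact Submodule.add_mem _ hx hy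
  | tmul a b =>
    obtain ⟨h, hh⟩ := Θ.projZero_mem_range b
    refine ⟨_, ⟨a ⊗ₜ h, rfl⟩, ?_⟩
    change toSkew Γ Θ (a ⊗ₜ Θ.incl h) = toSkew Γ Θ (a ⊗ₜ Θ.projZero b)
    rw [← hh]
    rfl

variable {Θ} (c : RightCovariant Θ)

theorem skewCoact_tmul (a : Γ.carrier) (b : Θ.carrier) :
    skewCoact Γ c (toSkew Γ Θ (a ⊗ₜ b)) = (toSkew Γ Θ).toLinearMap.rTensor H
      ((TensorProduct.assoc ℂ Γ.carrier Θ.carrier H).symm (a ⊗ₜ c.coact b)) := rfl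

theorem skewCoact_horCanonical (x : Skew Γ Θ) :
    skewCoact Γ c (horCanonical Γ Θ x) = (horCanonical Γ Θ).rTensor H (skewCoact Γ c x) := by
  induction x using skew_induction with
  | add x y hx hy => simp only [map_add, hx, hy]
  | tmul a b =>
    change skewCoact Γ c (toSkew Γ Θ (a ⊗ₜ Θ.projZero b)) = _
    rw [skewCoact_tmul, skewCoact_tmul, coact_projZero]
    generalize c.coact b = t
    induction t with
    | zero => simp
    | add s t hs ht => simp only [map_add, TensorProduct.tmul_add, hs, ht]
    | tmul b h => rfl

theorem skewCoact_mul_skewRight (a : Γ.carrier) (h : H) :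
    skewCoact Γ c (skewLeft Γ Θ a * skewRight Γ Θ h) =
      (LinearMap.mulLeft ℂ (skewLeft Γ Θ a) ∘ₗ (skewRight Γ Θ).toLinearMap).rTensor H
        (Coalgebra.comul (R := ℂ) h) := by
  rw [skewLeft_mul_skewRight, skewCoact_tmul, c.coact_incl]
  generalize Coalgebra.comul (R := ℂ) h = t
  induction t with
  | zero => simp
  | add s t hs ht => simp only [map_add, TensorProduct.tmul_add, hs, ht]
  | tmul h k =>
    simp only [LinearMap.rTensor_tmul, LinearMap.comp_apply, LinearMap.mulLeft_apply,
      AlgHom.toLinearMap_apply, skewLeft_mul_skewRight, TensorProduct.assoc_symm_tmul,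
      LinearEquiv.coe_coe]

theorem skewCoact_skewRight (h : H) : skewCoact Γ c (skewRight Γ Θ h) =
    (skewRight Γ Θ).toLinearMap.rTensor H (Coalgebra.comul (R := ℂ) h) := by
  have := skewCoact_mul_skewRight Γ c 1 h
  rwa [map_one, one_mul, LinearMap.mulLeft_one, LinearMap.id_comp] at this

theorem eq_of_mem_skewHor {x : Skew Γ Θ} (hx : x ∈ skewHor Γ Θ) :
    LinearMap.mul' ℂ _ (TensorProduct.map ((skewLeft Γ Θ).toLinearMap ∘ₗ idCounit Γ Θ)
      (skewRight Γ Θ).toLinearMap (skewCoact Γ c x)) = x := by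
  refine skewHor_induction Γ Θ (p := fun x => LinearMap.mul' ℂ _ (TensorProduct.map
    ((skewLeft Γ Θ).toLinearMap ∘ₗ idCounit Γ Θ) (skewRight Γ Θ).toLinearMap
      (skewCoact Γ c x)) = x) hx (fun a h => ?_) fun x y hx hy => by simp only [map_add, hx, hy]
  rw [skewCoact_mul_skewRight]
  have h1 (t : H ⊗[ℂ] H) : LinearMap.mul' ℂ _
      (TensorProduct.map ((skewLeft Γ Θ).toLinearMap ∘ₗ idCounit Γ Θ)
        (skewRight Γ Θ).toLinearMap
        ((LinearMap.mulLeft ℂ (skewLeft Γ Θ a) ∘ₗ (skewRight Γ Θ).toLinearMap).rTensor H t)) =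
      skewLeft Γ Θ a * skewRight Γ Θ (TensorProduct.lid ℂ H
        ((Coalgebra.counit (R := ℂ) (A := H)).rTensor H t)) := by
    induction t with
    | zero => simp
    | add s t hs ht => simp only [map_add, mul_add, hs, ht]
    | tmul h k =>
      simp only [LinearMap.rTensor_tmul, LinearMap.comp_apply, LinearMap.mulLeft_apply,
        AlgHom.toLinearMap_apply, TensorProduct.map_tmul, LinearMap.mul'_apply,
        skewLeft_mul_skewRight Γ Θ a h, idCounit_tmul, Θ.degreeZero_incl, map_smul,
        TensorProduct.lid_tmul, smul_mul_assoc, mul_smul_comm]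
  rw [h1, Coalgebra.rTensor_counit_comul, TensorProduct.lid_tmul, one_smul]

theorem eq_of_skewCoact_eq {x : Skew Γ Θ} (hx : x ∈ skewHor Γ Θ) {f : H →ₗ[ℂ] Skew Γ Θ}
    {t : H ⊗[ℂ] H} (h : skewCoact Γ c x = f.rTensor H t) :
    x = LinearMap.mul' ℂ _ (TensorProduct.map
      ((skewLeft Γ Θ).toLinearMap ∘ₗ idCounit Γ Θ ∘ₗ f) (skewRight Γ Θ).toLinearMap t) := by
  refine (eq_of_mem_skewHor Γ c hx).symm.trans ?_
  rw [h]
  clear h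
  induction t with
  | zero => simp
  | add s t hs ht => simp only [map_add, hs, ht]
  | tmul h k => simp

variable (Θ)

theorem toSkew_maurerCartanLeft (h : H) :
    toSkew Γ Θ (1 ⊗ₜ maurerCartanLeft Θ h) =
      (toConv ((skewRight Γ Θ).toLinearMap ∘ₗ HopfAlgebra.antipode ℂ) *
        toConv (skewD Γ Θ ∘ₗ (skewRight Γ Θ).toLinearMap)) h := by
  rw [LinearMap.convMul_apply]
  simp only [maurerCartanLeft, LinearMap.comp_apply]
  generalize Coalgebra.comul (R := ℂ) h = t
  induction t with
  | zero => simp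
  | add s t hs ht => simp only [map_add, TensorProduct.tmul_add, hs, ht]
  | tmul x y =>
    simp only [TensorProduct.map_tmul, LinearMap.mul'_apply, LinearMap.comp_apply,
      AlgHom.toLinearMap_apply, skewRight_apply, skewD_one_tmul]
    exact map_mul (GradedTensorProduct.includeRight Γ.grading Θ.grading) _ _

theorem toSkew_maurerCartanRight (hS : Function.Bijective (HopfAlgebra.antipode ℂ (A := H)))
    (h : H) :
    toSkew Γ Θ (1 ⊗ₜ maurerCartanRight Θ hS h) =
      unop ((opConv (toConv ((skewRight Γ Θ).toLinearMap ∘ₗ antipodeInv hS)) *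
        opConv (toConv (skewD Γ Θ ∘ₗ (skewRight Γ Θ).toLinearMap))) h) := by
  rw [LinearMap.convMul_apply]
  simp only [maurerCartanRight, LinearMap.comp_apply]
  generalize Coalgebra.comul (R := ℂ) h = t
  induction t with
  | zero => simp
  | add s t hs ht => simp only [map_add, TensorProduct.tmul_add, unop_add, hs, ht]
  | tmul x y =>
    simp only [TensorProduct.map_tmul, TensorProduct.comm_tmul, LinearMap.mul'_apply,
      LinearMap.comp_apply, LinearEquiv.coe_coe, AlgHom.toLinearMap_apply]
    refine (map_mul (GradedTensorProduct.includeRight Γ.grading Θ.grading) _ _).trans ?_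
    exact congrArg (· * _) (skewD_one_tmul Γ Θ (Θ.incl y)).symm

variable {Θ} (c : RightCovariant Θ)

theorem mul'_map_skewCoact (f : H →ₗ[ℂ] Skew Γ Θ) (a : Γ.carrier) (h : H) :
    LinearMap.mul' ℂ _ (TensorProduct.map LinearMap.id f
        (skewCoact Γ c (skewLeft Γ Θ a * skewRight Γ Θ h))) =
      skewLeft Γ Θ a * (toConv (skewRight Γ Θ).toLinearMap * toConv f) h := by
  rw [skewCoact_mul_skewRight, LinearMap.convMul_apply]
  generalize Coalgebra.comul (R := ℂ) h = t
  induction t with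
  | zero => simp
  | add s t hs ht => simp only [map_add, mul_add, hs, ht]
  | tmul x y => simp [mul_assoc]

theorem mul'_map_comm_skewCoact (f : H →ₗ[ℂ] Skew Γ Θ) (a : Γ.carrier) (h : H) :
    LinearMap.mul' ℂ _ (TensorProduct.map f LinearMap.id (TensorProduct.comm ℂ _ _
        (skewCoact Γ c (skewLeft Γ Θ a * skewRight Γ Θ h)))) =
      unop ((opConv (toConv (skewRight Γ Θ).toLinearMap) * opConv (toConv f)) h) *
        skewLeft Γ Θ a := by
  rw [skewCoact_mul_skewRight, LinearMap.convMul_apply]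
  generalize Coalgebra.comul (R := ℂ) h = t
  induction t with
  | zero => simp
  | add s t hs ht => simp only [map_add, unop_add, add_mul, hs, ht]
  | tmul x y =>
    have hcomm := (commute_skewLeft_skewRight Γ Θ a x).eq
    simpa [mul_assoc] using congrArg (f y * ·) hcomm

end Skew

namespace DifferentialStructure

variable {I B H P : Type*} [Ring B] [Algebra ℂ B] [Ring H]
  [HopfAlgebra ℂ H] [Ring P] [Algebra ℂ P] {Q : LocallyTrivialQPFB I B H P}
  (G : DifferentialStructure Q)

theorem exists_gammaB_of_mem_closure (i : I) {a : (G.calcB i).carrier}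
    (ha : a ∈ Submonoid.closure
      (Set.range (G.calcB i).incl ∪ Set.range fun b => (G.calcB i).d ((G.calcB i).incl b))) :
    ∃ m, ∃ γ ∈ G.gammaB, G.HasDegreeB m γ ∧ γ i = a := by
  have hπ (b : B) : G.HasDegreeB 0 (G.πTotal b) := fun k => (G.calcB k).incl_mem _
  induction ha using Submonoid.closure_induction with
  | mem a ha =>
    obtain ⟨b, rfl⟩ | ⟨b, rfl⟩ := ha <;> obtain ⟨b, rfl⟩ := Ideal.Quotient.mk_surjective b
    · exact ⟨0, G.πTotal b, Algebra.subset_adjoin (Or.inl ⟨b, rfl⟩), hπ b, rfl⟩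
    · exact ⟨1, G.dTotalB (G.πTotal b), Algebra.subset_adjoin (Or.inr ⟨b, rfl⟩),
        fun k => (G.calcB k).d_mem _ _ (hπ b k), rfl⟩
  | one => exact ⟨0, 1, one_mem _, fun k => SetLike.one_mem_graded _, rfl⟩
  | mul a b _ _ ha hb =>
    obtain ⟨m, γ, hγ, hm, rfl⟩ := ha
    obtain ⟨k, δ, hδ, hk, rfl⟩ := hb
    exact ⟨m + k, γ * δ, mul_mem hγ hδ, fun l => SetLike.mul_mem_graded (hm l) (hk l), rfl⟩

theorem exists_gammaB_eq_proj (i : I) (n : ℕ) (a : (G.calcB i).carrier) :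
    ∃ γ ∈ G.gammaB, G.HasDegreeB n γ ∧ γ i = GradedRing.proj (G.calcB i).grading n a := by
  have ha : a ∈ Subalgebra.toSubmodule (Algebra.adjoin ℂ (Set.range (G.calcB i).incl ∪
      Set.range fun b => (G.calcB i).d ((G.calcB i).incl b))) := by
    rw [(G.calcB i).generated]
    trivial
  rw [Algebra.adjoin_eq_span] at ha
  induction ha using Submodule.span_induction with
  | mem a ha =>
    obtain ⟨m, γ, hγ, hm, rfl⟩ := G.exists_gammaB_of_mem_closure i ha
    rcases eq_or_ne m n with rfl | hmn
    · exact ⟨γ, hγ, hm, (DirectSum.decompose_of_mem_same _ (hm i)).symm⟩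
    · exact ⟨0, zero_mem _, fun k => Submodule.zero_mem _,
        (DirectSum.decompose_of_mem_ne _ (hm i) hmn).symm⟩
  | zero => exact ⟨0, zero_mem _, fun k => Submodule.zero_mem _, by simp⟩
  | add a b _ _ ha hb =>
    obtain ⟨γ, hγ, hn, hi⟩ := ha
    obtain ⟨δ, hδ, hn', hi'⟩ := hb
    exact ⟨γ + δ, add_mem hγ hδ, fun k => Submodule.add_mem _ (hn k) (hn' k), by
      rw [Pi.add_apply, hi, hi', map_add]⟩
  | smul r a _ ha =>
    obtain ⟨γ, hγ, hn, hi⟩ := ha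
    refine ⟨r • γ, Subalgebra.smul_mem _ hγ r, fun k => Submodule.smul_mem _ r (hn k), ?_⟩
    rw [Pi.smul_apply, hi]
    exact ((GradedAlgebra.proj (G.calcB i).grading n).map_smul r a).symm

theorem exists_gammaCB_of_mem_grading (i : I) {n : ℕ} {a : (G.calcB i).carrier}
    (ha : a ∈ (G.calcB i).grading n) :
    ∃ γ : G.gammaCB, G.HasDegreeB n γ ∧ (γ : G.TotalB) i = a := by
  obtain ⟨γ, hγ, hn, hi⟩ := G.exists_gammaB_eq_proj i n a
  exact ⟨⟨γ, le_coveringCompletion _ hγ⟩, hn,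
    hi.trans (DirectSum.decompose_of_mem_same _ ha)⟩

theorem exists_hor_eq_skewRight (i : I) (h : H) :
    ∃ α : G.hor, G.HasDegree 0 α ∧
      (α : G.Total) i = skewRight (G.calcB i) G.calcH h := by
  obtain ⟨p, hp⟩ := Q.χ_surjective i (1 ⊗ₜ h)
  refine ⟨⟨G.χTotal p, le_coveringCompletion _ (Algebra.subset_adjoin (Or.inl ⟨p, rfl⟩)),
    fun k => skewIncl_mem_skewHor _ _ _⟩, fun k => skewIncl_mem_skewDegree _ _ _, ?_⟩
  change skewIncl _ _ (Q.χ i p) = _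
  rw [hp, skewIncl_one_tmul]

/-- The differential superalgebra `Γ(Bᵢ) ⊗̂ Γ(H)`. -/
abbrev localSuperDifferential (i : I) : SuperDifferential ℂ (G.Local i) :=
  skewSuperDifferential (G.calcB i) G.calcH

/-- The map `h ↦ 1 ⊗̂ h` into the `i`-th local calculus, as an element of the convolution algebra:
the cleaving map of the trivial bundle over `Bᵢ`. -/
abbrev fiber (i : I) : WithConv (H →ₗ[ℂ] G.Local i) :=
  toConv (skewRight (G.calcB i) G.calcH).toLinearMap

/-- The `i`-th component `χᵢ ∘ ω` of a form on `H`, as an element of the convolution algebra. -/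
abbrev component (ω : H →ₗ[ℂ] G.gammaCP) (i : I) : WithConv (H →ₗ[ℂ] G.Local i) :=
  toConv (LinearMap.proj i ∘ₗ G.toTotal ω)

/-- The local form `Aᵢ`, viewed in `Γ(Bᵢ) ⊗̂ Γ(H)`, as an element of the convolution algebra. -/
abbrev localComponent (ω : H →ₗ[ℂ] G.gammaCP) (i : I) : WithConv (H →ₗ[ℂ] G.Local i) :=
  convMap H (skewLeft (G.calcB i) G.calcH) (toConv (G.localForm ω i))

theorem commute_localComponent_fiber (ω : H →ₗ[ℂ] G.gammaCP) (i : I) (x y : H) :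
    Commute (G.localComponent ω i x) (skewRight (G.calcB i) G.calcH y) :=
  commute_skewLeft_skewRight (G.calcB i) G.calcH (G.localForm ω i x) y

theorem parity_fiber (i : I) :
    ((G.localSuperDifferential i).conv H).parity (G.fiber i) = G.fiber i := by
  ext h
  exact skewParity_skewRight (G.calcB i) G.calcH h

theorem parity_component {ω : H →ₗ[ℂ] G.gammaCP} (hω : ∀ h, G.HasDegree 1 (ω h)) (i : I) :
    ((G.localSuperDifferential i).conv H).parity (G.component ω i) = -G.component ω i := by
  ext h
  exact (skewParity_of_mem _ _ (hω h i)).trans (by simp [toTotal])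

theorem proj_comp_leftCurvatureForm (ω : H →ₗ[ℂ] G.gammaCP) (i : I) :
    toConv (LinearMap.proj i ∘ₗ G.leftCurvatureForm ω) =
      ((G.localSuperDifferential i).conv H).d (G.component ω i) -
        G.component ω i * G.component ω i := by
  ext h
  refine (map_sub (LinearMap.proj i : G.Total →ₗ[ℂ] G.Local i) _ _).trans (congrArg (_ - ·) ?_)
  refine Eq.trans ?_ (LinearMap.convMul_apply _ _ h).symm
  simp only [LinearMap.comp_apply]
  generalize Coalgebra.comul (R := ℂ) h = t
  induction t with
  | zero => simp
  | add s t hs ht => simp only [map_add, hs, ht]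
  | tmul x y => rfl

theorem proj_comp_rightCurvatureForm (ω : H →ₗ[ℂ] G.gammaCP) (i : I) :
    opConv (toConv (LinearMap.proj i ∘ₗ G.rightCurvatureForm ω)) =
      opConv (((G.localSuperDifferential i).conv H).d (G.component ω i)) +
        opConv (G.component ω i) * opConv (G.component ω i) := by
  ext h
  apply unop_injective
  refine (map_add (LinearMap.proj i : G.Total →ₗ[ℂ] G.Local i) _ _).trans (congrArg (_ + ·) ?_)
  refine Eq.trans ?_ (congrArg unop (LinearMap.convMul_apply _ _ h)).symm
  simp only [LinearMap.comp_apply]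
  generalize Coalgebra.comul (R := ℂ) h = t
  induction t with
  | zero => simp
  | add s t hs ht => simp only [map_add, unop_add, hs, ht]
  | tmul x y => rfl

section Coaction

variable [Fintype I] [DecidableEq I]

theorem rTensor_proj_coactTotal (x : G.Total) (i : I) :
    (LinearMap.proj i : G.Total →ₗ[ℂ] G.Local i).rTensor H (G.coactTotal x) =
      skewCoact (G.calcB i) G.covariant (x i) := by
  simp only [coactTotal, LinearMap.sum_apply, LinearMap.comp_apply, map_sum]
  rw [Finset.sum_eq_single i]
  · rw [← LinearMap.comp_apply, ← LinearMap.rTensor_comp, LinearMap.proj_comp_single_same,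
      LinearMap.rTensor_id]
    rfl
  · intro k _ hk
    rw [← LinearMap.comp_apply, ← LinearMap.rTensor_comp,
      LinearMap.proj_comp_single_ne ℂ G.Local _ _ hk.symm, LinearMap.rTensor_zero]
    rfl
  · simp

theorem rTensor_proj_coactHor (α : G.hor) (i : I) :
    (LinearMap.proj i ∘ₗ G.horIncl).rTensor H (G.coactHor α) =
      skewCoact (G.calcB i) G.covariant ((α : G.Total) i) := by
  rw [LinearMap.rTensor_comp, LinearMap.comp_apply, coactHor_eq, rTensor_proj_coactTotal]

theorem mulRight_coactHor_apply (Ω : H →ₗ[ℂ] G.Total) (γ : G.hor) (i : I) :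
    G.mulRight Ω (G.coactHor γ) i = LinearMap.mul' ℂ _ (TensorProduct.map LinearMap.id
      (LinearMap.proj i ∘ₗ Ω) (skewCoact (G.calcB i) G.covariant ((γ : G.Total) i))) := by
  rw [← rTensor_proj_coactHor]
  generalize G.coactHor γ = t
  induction t with
  | zero => simp
  | add s t hs ht => simp only [map_add, Pi.add_apply, hs, ht]
  | tmul α h => rfl

theorem mulLeft_coactHor_apply (Ω : H →ₗ[ℂ] G.Total) (γ : G.hor) (i : I) :
    G.mulLeft Ω (G.coactHor γ) i = LinearMap.mul' ℂ _ (TensorProduct.map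
      (LinearMap.proj i ∘ₗ Ω) LinearMap.id (TensorProduct.comm ℂ _ _
        (skewCoact (G.calcB i) G.covariant ((γ : G.Total) i)))) := by
  rw [← rTensor_proj_coactHor]
  generalize G.coactHor γ = t
  induction t with
  | zero => simp
  | add s t hs ht => simp only [map_add, Pi.add_apply, hs, ht]
  | tmul α h => rfl

variable {G} {D : G.hor →ₗ[ℂ] G.hor} {ω : H →ₗ[ℂ] G.gammaCP}

theorem IsCovariantDerivativeBase.exists_local (hD : G.IsCovariantDerivativeBase D) (i : I) :
    ∃ E : G.Local i →ₗ[ℂ] G.Local i, ∀ α : G.hor, (D α : G.Total) i = E ((α : G.Total) i) := by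
  let p : G.hor →ₗ[ℂ] G.Local i := LinearMap.proj i ∘ₗ G.horIncl
  obtain ⟨s, hs⟩ := p.rangeRestrict.exists_rightInverse_of_surjective p.range_rangeRestrict
  obtain ⟨E, hE⟩ := (p ∘ₗ D ∘ₗ s).exists_extend
  refine ⟨E, fun α => ?_⟩
  have hps : p (s (p.rangeRestrict α)) = p α :=
    congrArg Subtype.val (LinearMap.congr_fun hs (p.rangeRestrict α))
  have hEp : E (p α) = p (D (s (p.rangeRestrict α))) :=
    LinearMap.congr_fun hE (p.rangeRestrict α)
  have hDα := hD.localized i (α - s (p.rangeRestrict α)) (sub_eq_zero.2 hps.symm)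
  rw [map_sub] at hDα
  exact (sub_eq_zero.1 hDα).trans hEp.symm

theorem localForm_mem_grading (hD : G.IsCovariantDerivativeBase D) (hωD : G.Corresponds ω D)
    (i : I) (h : H) : G.localForm ω i h ∈ (G.calcB i).grading 1 := by
  obtain ⟨α, hα, hi⟩ := G.exists_hor_eq_skewRight i h
  rw [hωD i h α (by rw [hi, skewIncl_one_tmul])]
  exact Submodule.neg_mem _ (idCounit_mem _ _ (hD.degree 0 α hα i))

theorem parity_localForm (hD : G.IsCovariantDerivativeBase D) (hωD : G.Corresponds ω D) (i : I) :
    ((G.calcB i).superDifferential.conv H).parity (toConv (G.localForm ω i)) =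
      -toConv (G.localForm ω i) := by
  ext h
  exact ((G.calcB i).parity_of_mem (localForm_mem_grading hD hωD i h)).trans (by simp)

section Local

variable {i : I} {E : G.Local i →ₗ[ℂ] G.Local i}

theorem skewCoact_local_skewRight (hD : G.IsCovariantDerivativeBase D)
    (hE : ∀ α : G.hor, (D α : G.Total) i = E ((α : G.Total) i)) (h : H) :
    skewCoact (G.calcB i) G.covariant (E (skewRight (G.calcB i) G.calcH h)) =
      (E ∘ₗ (skewRight (G.calcB i) G.calcH).toLinearMap).rTensor H
        (Coalgebra.comul (R := ℂ) h) := by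
  obtain ⟨α, -, hi⟩ := G.exists_hor_eq_skewRight i h
  have hpD : (LinearMap.proj i ∘ₗ G.horIncl) ∘ₗ D = E ∘ₗ LinearMap.proj i ∘ₗ G.horIncl :=
    LinearMap.ext hE
  rw [← hi, ← hE, ← rTensor_proj_coactHor, ← hD.covariant, ← LinearMap.comp_apply,
    ← LinearMap.rTensor_comp, hpD, LinearMap.rTensor_comp, LinearMap.comp_apply,
    rTensor_proj_coactHor, hi, skewCoact_skewRight, ← LinearMap.comp_apply,
    ← LinearMap.rTensor_comp]

theorem Corresponds.local_comp_fiber (hωD : G.Corresponds ω D)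
    (hD : G.IsCovariantDerivativeBase D)
    (hE : ∀ α : G.hor, (D α : G.Total) i = E ((α : G.Total) i)) :
    toConv (E ∘ₗ (G.fiber i).ofConv) = -(G.localComponent ω i * G.fiber i) := by
  have hA : (skewLeft (G.calcB i) G.calcH).toLinearMap ∘ₗ idCounit (G.calcB i) G.calcH ∘ₗ
      E ∘ₗ (skewRight (G.calcB i) G.calcH).toLinearMap = (-G.localComponent ω i).ofConv := by
    ext k
    obtain ⟨β, -, hβ⟩ := G.exists_hor_eq_skewRight i k
    have hβD := hωD i k β (by rw [hβ, skewIncl_one_tmul])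
    rw [hE, hβ] at hβD
    change skewLeft _ _ (idCounit _ _ (E (skewRight _ _ k))) = -skewLeft _ _ (G.localForm ω i k)
    rw [hβD, map_neg, neg_neg]
  ext h
  obtain ⟨α, -, hi⟩ := G.exists_hor_eq_skewRight i h
  have hmem : E (skewRight (G.calcB i) G.calcH h) ∈ skewHor (G.calcB i) G.calcH := by
    rw [← hi, ← hE]
    exact (D α).2.2 i
  refine (eq_of_skewCoact_eq _ _ hmem (skewCoact_local_skewRight hD hE h)).trans ?_
  rw [hA, ← neg_mul (G.localComponent ω i)]
  rfl

theorem IsLeftCovariantDerivative.local_leibniz (hD : G.IsLeftCovariantDerivative D)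
    (hE : ∀ α : G.hor, (D α : G.Total) i = E ((α : G.Total) i))
    (a : (G.calcB i).carrier) (h : H) :
    E (skewLeft (G.calcB i) G.calcH a * G.fiber i h) =
      skewLeft (G.calcB i) G.calcH ((G.calcB i).d a) * G.fiber i h +
        skewLeft (G.calcB i) G.calcH ((G.calcB i).parity a) * E (G.fiber i h) := by
  induction a using (G.calcB i).induction_homogeneous with
  | add a b ha hb =>
    simp only [map_add, add_mul, ha, hb]
    abel
  | hom n a ha =>
    obtain ⟨γ, hγ, rfl⟩ := G.exists_gammaCB_of_mem_grading i ha
    obtain ⟨α, -, hi⟩ := G.exists_hor_eq_skewRight i h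
    have hDγα : E (skewLeft (G.calcB i) G.calcH ((γ : G.TotalB) i) * (α : G.Total) i) =
        skewD (G.calcB i) G.calcH (skewLeft (G.calcB i) G.calcH ((γ : G.TotalB) i)) *
          (α : G.Total) i + (-1 : ℂ) ^ n • (skewLeft (G.calcB i) G.calcH ((γ : G.TotalB) i) *
            (D α : G.Total) i) :=
      (hE (G.embedHor γ * α)).symm.trans (congrFun (hD.leibniz n γ α hγ) i)
    rw [hE α, hi, skewD_skewLeft] at hDγα
    rw [(G.calcB i).parity_of_mem ha, map_smul, smul_mul_assoc]
    exact hDγα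

theorem IsRightCovariantDerivative.local_leibniz (hD : G.IsRightCovariantDerivative D)
    (hE : ∀ α : G.hor, (D α : G.Total) i = E ((α : G.Total) i))
    (a : (G.calcB i).carrier) (h : H) :
    E (G.fiber i h * skewLeft (G.calcB i) G.calcH a) =
      E (G.fiber i h) * skewLeft (G.calcB i) G.calcH a +
        G.fiber i h * skewLeft (G.calcB i) G.calcH ((G.calcB i).d a) := by
  induction a using (G.calcB i).induction_homogeneous with
  | add a b ha hb =>
    simp only [map_add, mul_add, ha, hb]
    abel
  | hom n a ha =>
    obtain ⟨γ, -, rfl⟩ := G.exists_gammaCB_of_mem_grading i ha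
    obtain ⟨α, hα, hi⟩ := G.exists_hor_eq_skewRight i h
    have hDαγ : E ((α : G.Total) i * skewLeft (G.calcB i) G.calcH ((γ : G.TotalB) i)) =
        (D α : G.Total) i * skewLeft (G.calcB i) G.calcH ((γ : G.TotalB) i) +
          (-1 : ℂ) ^ 0 • ((α : G.Total) i *
            skewD (G.calcB i) G.calcH (skewLeft (G.calcB i) G.calcH ((γ : G.TotalB) i))) :=
      (hE (α * G.embedHor γ)).symm.trans (congrFun (hD.leibniz 0 γ α hα) i)
    rwa [hE α, hi, skewD_skewLeft, pow_zero, one_smul] at hDαγ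

end Local

theorem horCanonical_apply {r : H →ₗ[ℂ] H ⊗[ℂ] H} {h : H}
    (hr : G.coactTotal (ω h) = (G.toTotal ω).rTensor H (r h)) (i : I) :
    horCanonical (G.calcB i) G.calcH ((ω h : G.Total) i) =
      -LinearMap.mul' ℂ _ (TensorProduct.map (G.localComponent ω i).ofConv
        (skewRight (G.calcB i) G.calcH).toLinearMap (r h)) := by
  have hco : skewCoact (G.calcB i) G.covariant
      (horCanonical (G.calcB i) G.calcH ((ω h : G.Total) i)) =
        (horCanonical (G.calcB i) G.calcH ∘ₗ LinearMap.proj i ∘ₗ G.toTotal ω).rTensor H (r h) := by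
    rw [skewCoact_horCanonical, ← rTensor_proj_coactTotal, hr]
    simp only [LinearMap.rTensor_comp, LinearMap.comp_apply]
  have hA : (skewLeft (G.calcB i) G.calcH).toLinearMap ∘ₗ idCounit (G.calcB i) G.calcH ∘ₗ
      horCanonical (G.calcB i) G.calcH ∘ₗ LinearMap.proj i ∘ₗ G.toTotal ω =
        (-G.localComponent ω i).ofConv := by
    ext k
    change _ = -skewLeft _ _ (-_)
    rw [map_neg, neg_neg]
    rfl
  rw [eq_of_skewCoact_eq _ _ (horCanonical_mem_skewHor _ _ _) hco, hA]
  generalize r h = t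
  induction t with
  | zero => simp
  | add s t hs ht => simp only [map_add, hs, ht, neg_add]
  | tmul x y => simp

theorem IsLeftPreConnectionForm.fiber_mul_component (hω : G.IsLeftPreConnectionForm ω) (i : I) :
    G.fiber i * G.component ω i = -(G.localComponent ω i * G.fiber i +
      ((G.localSuperDifferential i).conv H).d (G.fiber i)) := by
  refine conv_mul_eq_of_apply_eq_adLeft (G.commute_localComponent_fiber ω i) fun h => ?_
  have hvert := hω.vertical i h
  rwa [horCanonical_apply (hω.covariant h) i, toSkew_maurerCartanLeft, sub_eq_iff_eq_add,
    ← neg_add] at hvert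

theorem IsRightPreConnectionForm.fiber_mul_component
    {hS : Function.Bijective (HopfAlgebra.antipode ℂ (A := H))}
    (hω : G.IsRightPreConnectionForm hS ω) (i : I) :
    opConv (G.fiber i) * opConv (G.component ω i) =
      -(opConv (G.localComponent ω i) * opConv (G.fiber i) +
        opConv (((G.localSuperDifferential i).conv H).d (G.fiber i))) := by
  refine opConv_mul_eq_of_apply_eq_adRight hS (G.commute_localComponent_fiber ω i) fun h => ?_
  have hvert := hω.vertical i h
  rwa [horCanonical_apply (hω.covariant h) i, toSkew_maurerCartanRight, sub_eq_iff_eq_add,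
    ← neg_add] at hvert

theorem IsLeftCovariantDerivative.sq_eq (hD : G.IsLeftCovariantDerivative D)
    (hω : G.IsLeftPreConnectionForm ω) (hωD : G.Corresponds ω D) (γ : G.hor) :
    (D (D γ) : G.Total) = G.mulRight (G.leftCurvatureForm ω) (G.coactHor γ) := by
  funext i
  have hD' := hD.toIsCovariantDerivativeBase
  obtain ⟨E, hE⟩ := hD'.exists_local i
  rw [hE, hE, mulRight_coactHor_apply]
  refine skewHor_induction (G.calcB i) G.calcH (p := fun x => E (E x) = LinearMap.mul' ℂ _
    (TensorProduct.map LinearMap.id _ (skewCoact (G.calcB i) G.covariant x))) (γ.2.2 i)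
    (fun a h => ?_) fun x y hx hy => by simp only [map_add, hx, hy]
  rw [mul'_map_skewCoact, proj_comp_leftCurvatureForm]
  exact SuperDifferential.sq_apply_mul (δL := (G.calcB i).superDifferential)
    (fun x => (skewD_skewLeft _ _ x).symm) (fun x => (skewParity_skewLeft _ _ x).symm)
    (hD.local_leibniz hE) (hωD.local_comp_fiber hD' hE) (G.parity_fiber i)
    (parity_localForm hD' hωD i) (hω.fiber_mul_component i) a h

theorem IsRightCovariantDerivative.sq_eq
    {hS : Function.Bijective (HopfAlgebra.antipode ℂ (A := H))}
    (hD : G.IsRightCovariantDerivative D)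
    (hω : G.IsRightPreConnectionForm hS ω) (hωD : G.Corresponds ω D) (γ : G.hor) :
    (D (D γ) : G.Total) = G.mulLeft (G.rightCurvatureForm ω) (G.coactHor γ) := by
  funext i
  have hD' := hD.toIsCovariantDerivativeBase
  obtain ⟨E, hE⟩ := hD'.exists_local i
  rw [hE, hE, mulLeft_coactHor_apply]
  refine skewHor_induction (G.calcB i) G.calcH (p := fun x => E (E x) = LinearMap.mul' ℂ _
    (TensorProduct.map _ LinearMap.id (TensorProduct.comm ℂ _ _
      (skewCoact (G.calcB i) G.covariant x)))) (γ.2.2 i)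
    (fun a h => ?_) fun x y hx hy => by simp only [map_add, hx, hy]
  rw [mul'_map_comm_skewCoact, proj_comp_rightCurvatureForm,
    (commute_skewLeft_skewRight _ _ a h).eq]
  exact SuperDifferential.sq_apply_mul_op (δL := (G.calcB i).superDifferential)
    (fun x => (skewD_skewLeft _ _ x).symm) (fun x => (skewParity_skewLeft _ _ x).symm)
    (commute_skewLeft_skewRight _ _) (hD.local_leibniz hE) (hωD.local_comp_fiber hD' hE)
    (G.parity_fiber i) (parity_localForm hD' hωD i) (hω.fiber_mul_component i)
    (G.parity_component hω.degree i) a h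

end Coaction

end DifferentialStructure

end QPFB

end

theorem proposition16 {I B H P : Type*} [Fintype I] [DecidableEq I] [Ring B] [Algebra ℂ B]
    [Ring H] [HopfAlgebra ℂ H] [Ring P] [Algebra ℂ P]
    (hS : Function.Bijective (HopfAlgebra.antipode ℂ (A := H)))
    (Q : QPFB.LocallyTrivialQPFB I B H P) (G : QPFB.DifferentialStructure Q) :
    (∀ (D : G.hor →ₗ[ℂ] G.hor) (ω : H →ₗ[ℂ] G.gammaCP),
      G.IsLeftCovariantDerivative D → G.IsLeftPreConnectionForm ω → G.Corresponds ω D →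
      ∀ γ : G.hor, (D (D γ) : G.Total) = G.mulRight (G.leftCurvatureForm ω) (G.coactHor γ)) ∧
    (∀ (D : G.hor →ₗ[ℂ] G.hor) (ω : H →ₗ[ℂ] G.gammaCP),
      G.IsRightCovariantDerivative D → G.IsRightPreConnectionForm hS ω → G.Corresponds ω D →
      ∀ γ : G.hor, (D (D γ) : G.Total) = G.mulLeft (G.rightCurvatureForm ω) (G.coactHor γ)) :=
  ⟨fun _ _ hD hω hωD => hD.sq_eq hω hωD, fun _ _ hD hω hωD => hD.sq_eq hω hωD⟩
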